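/- Let $k$ be a field and let $Q=(Q_0,Q_1;s,t)$ be a finite quiver. Let $kQ$ be its path algebra (paths are composed from right to left, i.e. $pq$ is "first $q$, then $p$"), let $J\subseteq kQ$ be the two-sided ideal generated by the arrows, let $\Lambda=kQ/J^2$, let $kQ_0\subseteq kQ$ be the subalgebra spanned by the trivial paths, and let $Q^{\mathrm{op}}$ be the opposite quiver, with the reversed arrow $\alpha^*\colon t(\alpha)\to s(\alpha)$ for every $\alpha\in Q_1$. A differential projective $\Lambda$-module is a pair $(M,d)$ of a projective left $\Lambda$-module $M$ (not necessarily finitely generated) and a $\Lambda$-endomorphism $d$ of $M$ with $d^2=0$. Let $\underline{\mathrm{Diff}}(\Lambda\text{-}\mathrm{Proj})$ be the homotopy category: its objects are the differential projective $\Lambda$-modules, and its morphisms $(M,d)\to(N,\delta)$ are the $\Lambda$-linear maps $f\colon M\to N$ with $fd=\delta f$, modulo the null-homotopic maps, i.e. those of the form $rd+\delta r$ with $r\colon M\to N$ a $\Lambda$-linear map. It is a triangulated category with shift $\Sigma(M,d)=(M,-d)$, whose exact triangles are those isomorphic to a mapping cone triangle $M\xrightarrow{f}N\to\operatorname{cone}(f)\to\Sigma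 M$, where $\operatorname{cone}(f)=M\oplus N$ with differential $(m,n)\mapsto(-dm,\,fm+\delta n)$. Let $C=\Lambda\otimes_{kQ_0}kQ^{\mathrm{op}}$, a projective left $\Lambda$-module, with the differential $$d(y\otimes z)=\sum_{\alpha\in Q_1}y\alpha\otimes\alpha^*z\qquad(y\in\Lambda,\ z\in kQ^{\mathrm{op}}).$$ Theorem. The triangulated category $\mathcal T=\underline{\mathrm{Diff}}(\Lambda\text{-}\mathrm{Proj})$ is compactly generated, and $C$ is a compact generator of it. That is: (1) $\mathcal T$ has all small coproducts; (2) $C$ is compact: for every set $\{T_\lambda\}_{\lambda\in L}$ of objects of $\mathcal T$ the natural map $\coprod_{\lambda}\operatorname{Hom}_{\mathcal T}(C,T_\lambda)\to\operatorname{Hom}_{\mathcal T}(C,\coprod_\lambda T_\lambda)$ is bijective; (3) if $T\in\mathcal T$ satisfies $\operatorname{Hom}_{\mathcal T}(\Sigma^nC,T)=0$ for all $n\in\mathbb Z$, then $T\simeq0$. -/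

import Mathlib

open CategoryTheory
open scoped TensorProduct DirectSum

universe u v w

noncomputable section

namespace DiffProjSqZero

/-! ### The path algebra of a finite quiver -/

section PathAlgebra

variable (k : Type u) [Field k] (V : Type v) [Quiver.{w} V]

/-- All paths of the quiver `V`, including the trivial ones: a path `p` is stored as
`⟨s(p), t(p), p⟩`. -/
abbrev TotalPath : Type (max v w) := Σ a b : V, Quiver.Path a b

/-- The path algebra `kQ`: the `k`-vector space with basis all paths, with the multiplication
given by the concatenation of paths (`pathMul`), and the unit `∑ e_i`. -/
def PathAlgebra : Type (max u v w) := TotalPath V →₀ k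

instance : AddCommGroup (PathAlgebra k V) := inferInstanceAs (AddCommGroup (TotalPath V →₀ k))

variable {V}

/-- The trivial path `e_i`. -/
def trivialPath (i : V) : TotalPath V := ⟨i, i, Quiver.Path.nil⟩

/-- An arrow, seen as a path of length one. -/
def arrowPath {a b : V} (α : a ⟶ b) : TotalPath V := ⟨a, b, α.toPath⟩

variable {k}

open Classical in
/-- The product `(c p)(d q)` of multiples of paths, with paths written from right to left:
it is `c d` times the path "first `q`, then `p`" if `t(q) = s(p)`, and `0` otherwise. -/
def mulSingle (p : TotalPath V) (c : k) (q : TotalPath V) (d : k) : TotalPath V →₀ k :=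
  if h : q.2.1 = p.1 then
    Finsupp.single ⟨q.1, p.2.1, q.2.2.comp (p.2.2.cast h.symm rfl)⟩ (c * d)
  else 0

/-- The bilinear extension of the product of paths. -/
def pathMul (x y : TotalPath V →₀ k) : TotalPath V →₀ k :=
  x.sum fun p c => y.sum fun q d => mulSingle p c q d

lemma mulSingle_zero_left (p q : TotalPath V) (d : k) : mulSingle p 0 q d = 0 := by
  unfold mulSingle; split_ifs <;> simp

lemma mulSingle_zero_right (p q : TotalPath V) (c : k) : mulSingle p c q 0 = 0 := by
  unfold mulSingle; split_ifs <;> simp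

lemma mulSingle_add_left (p q : TotalPath V) (c c' d : k) :
    mulSingle p (c + c') q d = mulSingle p c q d + mulSingle p c' q d := by
  unfold mulSingle; split_ifs <;> simp [add_mul]

lemma mulSingle_add_right (p q : TotalPath V) (c d d' : k) :
    mulSingle p c q (d + d') = mulSingle p c q d + mulSingle p c q d' := by
  unfold mulSingle; split_ifs <;> simp [mul_add]

lemma pathMul_single (p q : TotalPath V) (c d : k) :
    pathMul (Finsupp.single p c) (Finsupp.single q d) = mulSingle p c q d := by
  unfold pathMul
  rw [Finsupp.sum_single_index, Finsupp.sum_single_index]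
  · exact mulSingle_zero_right _ _ _
  · rw [Finsupp.sum_single_index] <;> simp [mulSingle_zero_left]

lemma add_pathMul (x y z : TotalPath V →₀ k) :
    pathMul (x + y) z = pathMul x z + pathMul y z := by
  refine Finsupp.sum_add_index' (fun p => ?_) (fun p c c' => ?_)
  · exact Finset.sum_eq_zero fun q _ => mulSingle_zero_left _ _ _
  · simp only [mulSingle_add_left]
    exact Finsupp.sum_add

lemma pathMul_add (x y z : TotalPath V →₀ k) :
    pathMul x (y + z) = pathMul x y + pathMul x z := by
  unfold pathMul
  rw [← Finsupp.sum_add]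
  refine Finsupp.sum_congr fun p _ => ?_
  exact Finsupp.sum_add_index' (fun q => mulSingle_zero_right _ _ _)
    (fun q d d' => mulSingle_add_right _ _ _ _ _)

lemma zero_pathMul (x : TotalPath V →₀ k) : pathMul 0 x = 0 := Finsupp.sum_zero_index

lemma pathMul_zero (x : TotalPath V →₀ k) : pathMul x 0 = 0 :=
  Finset.sum_eq_zero fun _ _ => Finsupp.sum_zero_index

lemma mulSingle_assoc (p q r : TotalPath V) (c d e : k) :
    pathMul (mulSingle p c q d) (Finsupp.single r e) =
      pathMul (Finsupp.single p c) (mulSingle q d r e) := by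
  obtain ⟨a, b, p⟩ := p
  obtain ⟨a', b', q⟩ := q
  obtain ⟨a'', b'', r⟩ := r
  by_cases h : b' = a
  · subst h
    by_cases h' : b'' = a'
    · subst h'
      simp [mulSingle, pathMul_single, -Finsupp.single_mul, mul_assoc, Quiver.Path.comp_assoc]
    · simp [mulSingle, h', pathMul_single, -Finsupp.single_mul, pathMul_zero]
  · by_cases h' : b'' = a'
    · subst h'
      simp [mulSingle, h, pathMul_single, -Finsupp.single_mul, zero_pathMul]
    · simp [mulSingle, h, h', zero_pathMul, pathMul_zero]

lemma pathMul_assoc (x y z : TotalPath V →₀ k) :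
    pathMul (pathMul x y) z = pathMul x (pathMul y z) := by
  induction x using Finsupp.induction_linear with
  | zero => simp [zero_pathMul]
  | add x x' h h' => simp [add_pathMul, h, h']
  | single p c =>
    induction y using Finsupp.induction_linear with
    | zero => simp [zero_pathMul, pathMul_zero]
    | add y y' h h' => simp [add_pathMul, pathMul_add, h, h']
    | single q d =>
      induction z using Finsupp.induction_linear with
      | zero => simp [pathMul_zero]
      | add z z' h h' => simp [pathMul_add, h, h']
      | single r e => rw [pathMul_single, pathMul_single, mulSingle_assoc]

lemma trivial_pathMul_single (i : V) (c : k) (p : TotalPath V) (d : k) [Decidable (p.2.1 = i)] :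
    pathMul (Finsupp.single (trivialPath i) c) (Finsupp.single p d) =
      if p.2.1 = i then Finsupp.single p (c * d) else 0 := by
  obtain ⟨a, b, p⟩ := p
  rw [pathMul_single]
  by_cases h : b = i
  · subst h; simp [mulSingle, trivialPath]
  · simp [mulSingle, trivialPath, h]

lemma pathMul_single_trivial (i : V) (c : k) (p : TotalPath V) (d : k) [Decidable (i = p.1)] :
    pathMul (Finsupp.single p d) (Finsupp.single (trivialPath i) c) =
      if i = p.1 then Finsupp.single p (d * c) else 0 := by
  obtain ⟨a, b, p⟩ := p
  rw [pathMul_single]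
  by_cases h : i = a
  · subst h; simp [mulSingle, trivialPath]
  · simp [mulSingle, trivialPath, h]

lemma sum_pathMul {ι : Type*} (s : Finset ι) (f : ι → TotalPath V →₀ k) (x : TotalPath V →₀ k) :
    pathMul (∑ i ∈ s, f i) x = ∑ i ∈ s, pathMul (f i) x :=
  map_sum (AddMonoidHom.mk' (fun y => pathMul y x) fun y z => add_pathMul y z x) f s

lemma pathMul_sum {ι : Type*} (s : Finset ι) (f : ι → TotalPath V →₀ k) (x : TotalPath V →₀ k) :
    pathMul x (∑ i ∈ s, f i) = ∑ i ∈ s, pathMul x (f i) :=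
  map_sum (AddMonoidHom.mk' (fun y => pathMul x y) fun y z => pathMul_add x y z) f s

variable [Fintype V]

/-- The element `∑ c(i) e_i`. -/
def vertexSum (c : V → k) : TotalPath V →₀ k := ∑ i, Finsupp.single (trivialPath i) (c i)

lemma vertexSum_pathMul_single (c : V → k) (p : TotalPath V) (d : k) :
    pathMul (vertexSum c) (Finsupp.single p d) = Finsupp.single p (c p.2.1 * d) := by
  classical
  rw [vertexSum, sum_pathMul]
  simp [trivial_pathMul_single]

lemma pathMul_single_vertexSum (c : V → k) (p : TotalPath V) (d : k) :
    pathMul (Finsupp.single p d) (vertexSum c) = Finsupp.single p (d * c p.1) := by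
  classical
  rw [vertexSum, pathMul_sum]
  simp [pathMul_single_trivial]

instance : Ring (PathAlgebra k V) where
  __ := (inferInstance : AddCommGroup (PathAlgebra k V))
  mul := pathMul
  one := vertexSum 1
  left_distrib := pathMul_add
  right_distrib := add_pathMul
  zero_mul := zero_pathMul
  mul_zero := pathMul_zero
  mul_assoc := pathMul_assoc
  one_mul x := by
    change pathMul (vertexSum 1) x = x
    induction x using Finsupp.induction_linear with
    | zero => exact pathMul_zero _
    | add x y h h' => rw [pathMul_add, h, h']
    | single p c => simp [vertexSum_pathMul_single]
  mul_one x := by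
    change pathMul x (vertexSum 1) = x
    induction x using Finsupp.induction_linear with
    | zero => exact zero_pathMul _
    | add x y h h' => rw [add_pathMul, h, h']
    | single p c => simp [pathMul_single_vertexSum]

namespace PathAlgebra

/-- The subalgebra `kQ_0` of `kQ` spanned by the trivial paths is the commutative ring `V → k` of
functions on the vertices; this is its embedding `c ↦ ∑ c(i) e_i`. -/
def vertexHom : (V → k) →+* PathAlgebra k V where
  toFun c := vertexSum c
  map_zero' := by
    change vertexSum (0 : V → k) = (0 : TotalPath V →₀ k)
    simp [vertexSum]
  map_one' := rfl
  map_add' c d := by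
    change vertexSum (c + d) = (vertexSum c + vertexSum d : TotalPath V →₀ k)
    simp [vertexSum, Finset.sum_add_distrib]
  map_mul' c d := by
    change vertexSum (c * d) = pathMul (vertexSum c) (vertexSum d)
    conv_rhs => rw [vertexSum.eq_def d, pathMul_sum]
    simp only [vertexSum_pathMul_single]
    rfl

/-- An arrow `α`, seen as an element of the path algebra. -/
def arrow {a b : V} (α : a ⟶ b) : PathAlgebra k V := Finsupp.single (arrowPath α) (1 : k)

lemma vertexHom_mul_arrow {a b : V} (α : a ⟶ b) (c d : V → k) (h : c b = d a) :
    vertexHom c * arrow α = arrow α * vertexHom d :=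
  (vertexSum_pathMul_single c (arrowPath α) 1).trans <|
    (congrArg (Finsupp.single (arrowPath α)) (by simp [arrowPath, h])).trans
      (pathMul_single_vertexSum d (arrowPath α) 1).symm

end PathAlgebra

end PathAlgebra

/-! ### The radical square zero algebra `kQ/J²` -/

section RadSqZero

variable (k : Type u) [Field k] (V : Type v) [Quiver.{w} V] [Fintype V]

/-- The arrow ideal `J` of `kQ`: the two-sided ideal generated by all arrows. -/
def arrowIdeal : Ideal (PathAlgebra k V) :=
  (TwoSidedIdeal.span {x : PathAlgebra k V |
    ∃ (a b : V) (α : a ⟶ b), x = PathAlgebra.arrow α}).asIdeal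

instance : (arrowIdeal k V).IsTwoSided := by unfold arrowIdeal; infer_instance

/-- The radical square zero algebra `kQ/J²`. -/
def RadSqZero : Type (max u v w) := PathAlgebra k V ⧸ (arrowIdeal k V ^ 2)

instance : Ring (RadSqZero k V) := inferInstanceAs (Ring (PathAlgebra k V ⧸ (arrowIdeal k V ^ 2)))

variable {k V}

/-- The projection `kQ → kQ/J²`. -/
def toRadSqZero : PathAlgebra k V →+* RadSqZero k V := Ideal.Quotient.mk (arrowIdeal k V ^ 2)

lemma arrow_mem {a b : V} (α : a ⟶ b) : (PathAlgebra.arrow α : PathAlgebra k V) ∈ arrowIdeal k V :=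
  TwoSidedIdeal.mem_asIdeal.2 (TwoSidedIdeal.subset_span ⟨a, b, α, rfl⟩)

lemma arrow_mul_arrow {a b c d : V} (α : a ⟶ b) (β : c ⟶ d) :
    toRadSqZero (PathAlgebra.arrow (k := k) α) * toRadSqZero (PathAlgebra.arrow β) = 0 := by
  rw [← map_mul]
  refine Ideal.Quotient.eq_zero_iff_mem.2 ?_
  rw [Submodule.pow_succ, Submodule.pow_one]
  exact Ideal.mul_mem_mul (arrow_mem α) (arrow_mem β)

end RadSqZero

/-! ### The bimodule tensor product `kQ/J² ⊗_{kQ_0} kQ^op` -/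

section Tensor

variable (k : Type u) [Field k] (V : Type v) [Quiver.{w} V] [Fintype V]

instance : Fintype Vᵒᵖ := Fintype.ofEquiv V Opposite.equivToOpposite

/-- `kQ/J²` as a right module over the commutative ring `kQ_0`: the action is `y c`. -/
instance vertexModuleRadSqZero : Module (V → k) (RadSqZero k V) where
  smul c y := y * toRadSqZero (PathAlgebra.vertexHom c)
  one_smul y := by change y * _ = y; rw [map_one, map_one, mul_one]
  mul_smul c d y := by
    change y * _ = (y * _) * _
    rw [mul_comm c d, map_mul, map_mul, mul_assoc]
  smul_zero c := by change 0 * _ = _; rw [zero_mul]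
  zero_smul c := by change c * _ = _; rw [map_zero, map_zero, mul_zero]
  smul_add c x y := by change (x + y) * _ = x * _ + y * _; rw [add_mul]
  add_smul c d y := by change y * _ = y * _ + y * _; rw [map_add, map_add, mul_add]

/-- The embedding of `kQ_0` into `kQ^op`. -/
def vertexHomOp : (V → k) →+* PathAlgebra k Vᵒᵖ :=
  PathAlgebra.vertexHom.comp (RingHom.pi fun i : Vᵒᵖ => Pi.evalRingHom (fun _ : V => k) i.unop)

/-- `kQ^op` as a left module over `kQ_0`: the action is `c z`. -/
instance vertexModuleOp : Module (V → k) (PathAlgebra k Vᵒᵖ) :=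
  Module.compHom _ (vertexHomOp k V)

variable {k V}

lemma vertex_smul_radSqZero (c : V → k) (y : RadSqZero k V) :
    c • y = y * toRadSqZero (PathAlgebra.vertexHom c) := rfl

lemma vertex_smul_op (c : V → k) (z : PathAlgebra k Vᵒᵖ) :
    c • z = vertexHomOp k V c * z := rfl

instance : SMulCommClass (V → k) (RadSqZero k V) (RadSqZero k V) where
  smul_comm c x y := by
    simp only [vertex_smul_radSqZero, smul_eq_mul, mul_assoc]

variable (k V)

/-- The left `kQ/J²`-module `kQ/J² ⊗_{kQ_0} kQ^op`. -/
abbrev GenCarrier : Type (max u v w) := RadSqZero k V ⊗[V → k] PathAlgebra k Vᵒᵖ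

variable {k V}

/-- The summand `y ⊗ z ↦ yα ⊗ α*z` of the differential. -/
def arrowTerm {a b : V} (α : a ⟶ b) : GenCarrier k V →+ GenCarrier k V :=
  TensorProduct.liftAddHom
    { toFun := fun y =>
        { toFun := fun z => (y * toRadSqZero (PathAlgebra.arrow α)) ⊗ₜ[V → k]
            (PathAlgebra.arrow α.op * z)
          map_zero' := by rw [mul_zero, TensorProduct.tmul_zero]
          map_add' := fun z z' => by rw [mul_add, TensorProduct.tmul_add] }
      map_zero' := by ext z; simp
      map_add' := fun y y' => by ext z; simp [add_mul, TensorProduct.add_tmul] }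
    (fun c y z => by
      have h1 : toRadSqZero (PathAlgebra.vertexHom c) * toRadSqZero (PathAlgebra.arrow α) =
          toRadSqZero (k := k) (PathAlgebra.arrow α) *
            toRadSqZero (PathAlgebra.vertexHom fun _ => c b) := by
        rw [← map_mul, ← map_mul, PathAlgebra.vertexHom_mul_arrow α c (fun _ => c b) rfl]
      have h2 : PathAlgebra.arrow α.op * vertexHomOp k V c =
          vertexHomOp k V (fun _ => c b) * PathAlgebra.arrow α.op :=
        (PathAlgebra.vertexHom_mul_arrow α.op _ _ rfl).symm
      simp only [AddMonoidHom.coe_mk, ZeroHom.coe_mk]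
      rw [vertex_smul_radSqZero, vertex_smul_op, mul_assoc, ← mul_assoc (PathAlgebra.arrow α.op),
        h1, h2, ← mul_assoc, mul_assoc (vertexHomOp k V _), ← vertex_smul_op,
        ← vertex_smul_radSqZero, TensorProduct.smul_tmul])

lemma arrowTerm_tmul {a b : V} (α : a ⟶ b) (y : RadSqZero k V) (z : PathAlgebra k Vᵒᵖ) :
    arrowTerm α (y ⊗ₜ[V → k] z) = (y * toRadSqZero (PathAlgebra.arrow α)) ⊗ₜ[V → k]
      (PathAlgebra.arrow α.op * z) := rfl

variable (k V)

/-- `kQ/J² ⊗_{kQ_0} kQ^op` is projective, because every `kQ_0`-module is. -/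
lemma genCarrier_projective : Module.Projective (RadSqZero k V) (GenCarrier k V) := by
  have hP : Module.Projective (V → k) (PathAlgebra k Vᵒᵖ) :=
    Module.projective_of_isSemisimpleRing _ _
  obtain ⟨s, hs⟩ := hP.out
  refine Module.Projective.of_lifting_property'' fun f hf => ?_
  choose n hn using fun z : PathAlgebra k Vᵒᵖ => hf ((1 : RadSqZero k V) ⊗ₜ[V → k] z)
  let ι : (V → k) →+* RadSqZero k V := toRadSqZero.comp PathAlgebra.vertexHom
  let φ : PathAlgebra k Vᵒᵖ → GenCarrier k V →₀ RadSqZero k V :=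
    fun z => (s z).sum fun z' c => ι c • n z'
  have φ_add (z z' : PathAlgebra k Vᵒᵖ) : φ (z + z') = φ z + φ z' := by
    simp only [φ, map_add]
    exact Finsupp.sum_add_index' (by simp) (by simp [add_smul])
  have φ_smul (c : V → k) (z : PathAlgebra k Vᵒᵖ) : φ (c • z) = ι c • φ z := by
    simp only [φ, map_smul]
    rw [Finsupp.sum_smul_index' (by simp), Finsupp.smul_sum]
    simp [mul_smul]
  have hι (c : V → k) (y : RadSqZero k V) : c • y = y * ι c := rfl
  have fφ (z : PathAlgebra k Vᵒᵖ) : f (φ z) = 1 ⊗ₜ z := by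
    conv_rhs => rw [← hs z, Finsupp.linearCombination_apply, Finsupp.sum,
      TensorProduct.tmul_sum]
    simp only [φ, Finsupp.sum, map_sum, map_smul, hn, id]
    refine Finset.sum_congr rfl fun z' _ => ?_
    rw [← TensorProduct.smul_tmul, TensorProduct.smul_tmul', hι, smul_eq_mul, one_mul, mul_one]
  let g : GenCarrier k V →+ (GenCarrier k V →₀ RadSqZero k V) :=
    TensorProduct.liftAddHom
      { toFun := fun y => (DistribSMul.toAddMonoidHom _ y).comp (AddMonoidHom.mk' φ φ_add)
        map_zero' := by ext z : 1; simp
        map_add' := fun y y' => by ext z : 1; simp [add_smul] }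
      (fun c y z => by simp [φ_smul, hι, mul_smul])
  have g_tmul (y : RadSqZero k V) (z : PathAlgebra k Vᵒᵖ) : g (y ⊗ₜ z) = y • φ z := rfl
  refine ⟨{ toFun := g, map_add' := map_add g, map_smul' := fun r x => ?_ }, ?_⟩
  · induction x using TensorProduct.induction_on with
    | zero => simp
    | add x y h h' => simp only [smul_add, map_add, h, h']
    | tmul y z => rw [TensorProduct.smul_tmul', g_tmul, g_tmul, smul_eq_mul, mul_smul]; rfl
  · ext x
    change f (g x) = x
    induction x using TensorProduct.induction_on with
    | zero => simp
    | add x y h h' => rw [map_add, map_add, h, h']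
    | tmul y z => rw [g_tmul, map_smul, fφ, TensorProduct.smul_tmul', smul_eq_mul, mul_one]

variable [∀ a b : V, Fintype (a ⟶ b)]

/-- The differential `d(y ⊗ z) = ∑_α yα ⊗ α*z` (see `genDifferential_tmul`), as a
`kQ/J²`-linear map. -/
def genDifferential : GenCarrier k V →ₗ[RadSqZero k V] GenCarrier k V where
  toFun x := ∑ a : V, ∑ b : V, ∑ α : a ⟶ b, arrowTerm α x
  map_add' x y := by simp [Finset.sum_add_distrib]
  map_smul' r x := by
    simp only [RingHom.id_apply, Finset.smul_sum]
    refine Finset.sum_congr rfl fun a _ => Finset.sum_congr rfl fun b _ =>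
      Finset.sum_congr rfl fun α _ => ?_
    induction x using TensorProduct.induction_on with
    | zero => simp
    | add x y h h' => simp [h, h']
    | tmul y z =>
      rw [TensorProduct.smul_tmul', arrowTerm_tmul, arrowTerm_tmul, TensorProduct.smul_tmul',
        smul_eq_mul, smul_eq_mul, mul_assoc]

lemma genDifferential_tmul (y : RadSqZero k V) (z : PathAlgebra k Vᵒᵖ) :
    genDifferential k V (y ⊗ₜ[V → k] z) = ∑ a : V, ∑ b : V, ∑ α : a ⟶ b,
      (y * toRadSqZero (PathAlgebra.arrow α)) ⊗ₜ[V → k] (PathAlgebra.arrow α.op * z) := rfl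

lemma genDifferential_sq : genDifferential k V ∘ₗ genDifferential k V = 0 := by
  ext x
  simp only [LinearMap.comp_apply, LinearMap.zero_apply]
  induction x using TensorProduct.induction_on with
  | zero => simp
  | add x y h h' => simp [h, h']
  | tmul y z =>
    rw [genDifferential_tmul]
    simp only [map_sum]
    refine Finset.sum_eq_zero fun a _ => Finset.sum_eq_zero fun b _ =>
      Finset.sum_eq_zero fun α _ => ?_
    rw [genDifferential_tmul]
    refine Finset.sum_eq_zero fun c _ => Finset.sum_eq_zero fun d _ =>
      Finset.sum_eq_zero fun β _ => ?_
    rw [mul_assoc, arrow_mul_arrow, mul_zero, TensorProduct.zero_tmul]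

end Tensor

/-! ### Differential projective modules and their homotopy category -/

/-- A differential projective `R`-module `(M, d)`. -/
structure DiffProj (R : Type u) [Ring R] : Type (max u (w + 1)) where
  /-- the underlying module -/
  carrier : Type w
  [addCommGroup : AddCommGroup carrier]
  [module : Module R carrier]
  projective : Module.Projective R carrier
  /-- the differential -/
  d : carrier →ₗ[R] carrier
  d_comp_d : d ∘ₗ d = 0

attribute [instance] DiffProj.addCommGroup DiffProj.module

namespace DiffProj

variable {R : Type u} [Ring R]

/-- A differential module map `f : (M, d) → (N, δ)`, i.e. a module map with `f d = δ f`. -/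
@[ext]
structure Hom (M N : DiffProj.{u, w} R) : Type w where
  /-- the underlying module map -/
  map : M.carrier →ₗ[R] N.carrier
  comm : map ∘ₗ M.d = N.d ∘ₗ map

instance : Category.{w} (DiffProj.{u, w} R) where
  Hom := Hom
  id M := ⟨LinearMap.id, rfl⟩
  comp f g := ⟨g.map ∘ₗ f.map, by
    rw [LinearMap.comp_assoc, f.comm, ← LinearMap.comp_assoc, g.comm, LinearMap.comp_assoc]⟩

@[ext]
lemma hom_ext {M N : DiffProj.{u, w} R} {f g : M ⟶ N} (h : f.map = g.map) : f = g := Hom.ext h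

@[simp] lemma id_map (M : DiffProj.{u, w} R) : Hom.map (𝟙 M) = LinearMap.id := rfl

@[simp] lemma comp_map {M N P : DiffProj.{u, w} R} (f : M ⟶ N) (g : N ⟶ P) :
    (f ≫ g).map = g.map ∘ₗ f.map := rfl

section

variable {M N : DiffProj.{u, w} R}

instance : Zero (M ⟶ N) := ⟨⟨0, by simp⟩⟩
instance : Add (M ⟶ N) :=
  ⟨fun f g => ⟨f.map + g.map, by rw [LinearMap.add_comp, LinearMap.comp_add, f.comm, g.comm]⟩⟩
instance : Neg (M ⟶ N) :=
  ⟨fun f => ⟨-f.map, by rw [LinearMap.neg_comp, LinearMap.comp_neg, f.comm]⟩⟩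
instance : Sub (M ⟶ N) :=
  ⟨fun f g => ⟨f.map - g.map, by rw [LinearMap.sub_comp, LinearMap.comp_sub, f.comm, g.comm]⟩⟩
instance : SMul ℕ (M ⟶ N) :=
  ⟨fun n f => ⟨n • f.map, by rw [LinearMap.smul_comp, LinearMap.comp_smul, f.comm]⟩⟩
instance : SMul ℤ (M ⟶ N) :=
  ⟨fun n f => ⟨n • f.map, by rw [LinearMap.smul_comp, LinearMap.comp_smul, f.comm]⟩⟩

@[simp] lemma zero_map : (0 : M ⟶ N).map = 0 := rfl
@[simp] lemma add_map (f g : M ⟶ N) : (f + g).map = f.map + g.map := rfl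
@[simp] lemma neg_map (f : M ⟶ N) : (-f).map = -f.map := rfl
@[simp] lemma sub_map (f g : M ⟶ N) : (f - g).map = f.map - g.map := rfl

instance : AddCommGroup (M ⟶ N) :=
  Function.Injective.addCommGroup (fun f : M ⟶ N => f.map) (fun _ _ h => hom_ext h)
    rfl (fun _ _ => rfl) (fun _ => rfl) (fun _ _ => rfl) (fun _ _ => rfl) (fun _ _ => rfl)

end

instance : Preadditive (DiffProj.{u, w} R) where
  homGroup _ _ := inferInstance
  add_comp _ _ _ f f' g := by ext1; exact LinearMap.comp_add _ _ _
  comp_add _ _ _ f g g' := by ext1; exact LinearMap.add_comp _ _ _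

/-- A map `f : (M, d) → (N, δ)` is null homotopic if `f = r d + δ r` for a module map `r`. -/
def NullHomotopic {M N : DiffProj.{u, w} R} (f : M ⟶ N) : Prop :=
  ∃ r : M.carrier →ₗ[R] N.carrier, f.map = r ∘ₗ M.d + N.d ∘ₗ r

variable (R) in
/-- Two maps are homotopic if their difference is null homotopic. -/
def homotopyRel : HomRel (DiffProj.{u, w} R) := fun _ _ f g => NullHomotopic (f - g)

instance : Congruence (homotopyRel.{u, w} R) where
  equivalence :=
    { refl := fun f => ⟨0, by simp⟩
      symm := by
        rintro f g ⟨r, hr⟩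
        refine ⟨-r, ?_⟩
        rw [sub_map] at hr ⊢
        rw [← neg_sub, hr, LinearMap.neg_comp, LinearMap.comp_neg]
        abel
      trans := by
        rintro f g h ⟨r, hr⟩ ⟨s, hs⟩
        refine ⟨r + s, ?_⟩
        rw [sub_map] at hr hs ⊢
        rw [← sub_add_sub_cancel, hr, hs, LinearMap.add_comp, LinearMap.comp_add]
        abel }
  comp_left := by
    rintro M N P f g g' ⟨r, hr⟩
    refine ⟨r ∘ₗ f.map, ?_⟩
    rw [← Preadditive.comp_sub, comp_map, hr, LinearMap.add_comp, LinearMap.comp_assoc, ← f.comm]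
    rfl
  comp_right := by
    rintro M N P f f' g ⟨r, hr⟩
    refine ⟨g.map ∘ₗ r, ?_⟩
    rw [← Preadditive.sub_comp, comp_map, hr, LinearMap.comp_add, ← LinearMap.comp_assoc,
      ← LinearMap.comp_assoc, g.comm]
    rfl

/-! #### The shift: `Σⁿ(M, d) = (M, (-1)ⁿ d)` -/

/-- `Σⁿ(M, d) = (M, (-1)ⁿ d)`; in particular `Σ(M, d) = (M, -d)`. -/
@[simps carrier d]
def shiftObj (M : DiffProj.{u, w} R) (n : ℤ) : DiffProj.{u, w} R where
  carrier := M.carrier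
  projective := M.projective
  d := (n.negOnePow : ℤ) • M.d
  d_comp_d := by rw [LinearMap.smul_comp, LinearMap.comp_smul, M.d_comp_d, smul_zero, smul_zero]

variable (R) in
/-- The functor `Σⁿ`, which is the identity on the underlying module maps. -/
@[simps]
def shiftFun (n : ℤ) : DiffProj.{u, w} R ⥤ DiffProj.{u, w} R where
  obj M := M.shiftObj n
  map f := ⟨f.map, by
    change f.map ∘ₗ ((n.negOnePow : ℤ) • _) = ((n.negOnePow : ℤ) • _) ∘ₗ f.map
    rw [LinearMap.smul_comp, LinearMap.comp_smul, f.comm]⟩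
  map_id _ := rfl
  map_comp _ _ := rfl

/-- The isomorphism `(M, d) ≅ (M, d')` given by the identity of `M`, when `d = d'`. -/
def isoOfEq (M : DiffProj.{u, w} R) (m n : ℤ) (h : (m.negOnePow : ℤ) = n.negOnePow) :
    M.shiftObj m ≅ M.shiftObj n where
  hom := ⟨LinearMap.id, by
    change LinearMap.id ∘ₗ ((m.negOnePow : ℤ) • M.d) = ((n.negOnePow : ℤ) • M.d) ∘ₗ LinearMap.id
    rw [h]; rfl⟩
  inv := ⟨LinearMap.id, by
    change LinearMap.id ∘ₗ ((n.negOnePow : ℤ) • M.d) = ((m.negOnePow : ℤ) • M.d) ∘ₗ LinearMap.id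
    rw [h]; rfl⟩
  hom_inv_id := rfl
  inv_hom_id := rfl

lemma eqToHom_map (M : DiffProj.{u, w} R) {m n : ℤ} (h : m = n) :
    (eqToHom (congrArg M.shiftObj h)).map = (LinearMap.id : M.carrier →ₗ[R] M.carrier) := by
  subst h; rfl

variable (R) in
/-- The isomorphism `Σ⁰ ≅ 𝟭`. -/
def shiftZero : shiftFun.{u, w} R 0 ≅ 𝟭 (DiffProj.{u, w} R) :=
  NatIso.ofComponents (fun M =>
    { hom := ⟨LinearMap.id, by
        change LinearMap.id ∘ₗ (((0 : ℤ).negOnePow : ℤ) • M.d) = M.d ∘ₗ LinearMap.id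
        simp⟩
      inv := ⟨LinearMap.id, by
        change LinearMap.id ∘ₗ M.d = (((0 : ℤ).negOnePow : ℤ) • M.d) ∘ₗ LinearMap.id
        simp⟩
      hom_inv_id := rfl
      inv_hom_id := rfl }) (fun _ => rfl)

variable (R) in
/-- The isomorphism `Σᵐ⁺ⁿ ≅ Σⁿ Σᵐ`. -/
def shiftAdd (m n : ℤ) : shiftFun.{u, w} R (m + n) ≅ shiftFun R m ⋙ shiftFun R n :=
  NatIso.ofComponents (fun M =>
    { hom := ⟨LinearMap.id, by
        change LinearMap.id ∘ₗ (((m + n).negOnePow : ℤ) • M.d) =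
          ((n.negOnePow : ℤ) • (m.negOnePow : ℤ) • M.d) ∘ₗ LinearMap.id
        rw [Int.negOnePow_add, smul_smul, mul_comm, Units.val_mul]; rfl⟩
      inv := ⟨LinearMap.id, by
        change LinearMap.id ∘ₗ ((n.negOnePow : ℤ) • (m.negOnePow : ℤ) • M.d) =
          (((m + n).negOnePow : ℤ) • M.d) ∘ₗ LinearMap.id
        rw [Int.negOnePow_add, smul_smul, mul_comm, Units.val_mul]; rfl⟩
      hom_inv_id := rfl
      inv_hom_id := rfl }) (fun _ => rfl)

instance : HasShift (DiffProj.{u, w} R) ℤ :=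
  hasShiftMk _ ℤ
    { F := shiftFun R
      zero := shiftZero R
      add := shiftAdd R
      assoc_hom_app := fun m₁ m₂ m₃ M => by
        ext1
        rw [comp_map, comp_map, comp_map]
        erw [eqToHom_map M (add_assoc m₁ m₂ m₃)]
        rfl
      zero_add_hom_app := fun n M => by
        ext1
        rw [comp_map]
        erw [eqToHom_map M (zero_add n)]
        rfl
      add_zero_hom_app := fun n M => by
        ext1
        rw [comp_map]
        erw [eqToHom_map M (add_zero n)]
        rfl }

lemma shift_obj (M : DiffProj.{u, w} R) (n : ℤ) : M⟦n⟧ = M.shiftObj n := rfl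

lemma shift_map {M N : DiffProj.{u, w} R} (f : M ⟶ N) (n : ℤ) :
    (f⟦n⟧').map = f.map := rfl

instance : (homotopyRel.{u, w} R).IsCompatibleWithShift ℤ where
  condition n M N f g := by
    rintro ⟨r, hr⟩
    refine ⟨(n.negOnePow : ℤ) • r, ?_⟩
    change f.map - g.map = (((n.negOnePow : ℤ) • r) ∘ₗ ((n.negOnePow : ℤ) • M.d) : _ →ₗ[R] _) +
      ((n.negOnePow : ℤ) • N.d) ∘ₗ ((n.negOnePow : ℤ) • r)
    have h : (n.negOnePow : ℤ) * n.negOnePow = 1 := by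
      rw [← Units.val_mul, ← Int.negOnePow_add, Int.negOnePow_even _ ⟨n, rfl⟩]; rfl
    rw [LinearMap.smul_comp, LinearMap.comp_smul, LinearMap.smul_comp, LinearMap.comp_smul,
      smul_smul, smul_smul, h, one_smul, one_smul]
    exact hr

end DiffProj

open DiffProj

/-- The homotopy category of differential projective `R`-modules: the objects are the
differential projective modules, the morphisms are the homotopy classes of maps, and the shift
is induced by that of `DiffProj R`. -/
abbrev HoDiffProj (R : Type u) [Ring R] : Type (max u (w + 1)) :=
  Quotient (homotopyRel.{u, w} R)

section HoDiffProj

variable (R : Type u) [Ring R]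

instance : Preadditive (HoDiffProj.{u, w} R) :=
  Quotient.preadditive _ (by
    rintro M N f f' g g' ⟨r, hr⟩ ⟨s, hs⟩
    refine ⟨r + s, ?_⟩
    rw [sub_map] at hr hs ⊢
    rw [add_map, add_map, add_sub_add_comm, hr, hs, LinearMap.add_comp, LinearMap.comp_add]
    abel)

/-- The projection functor to the homotopy category. -/
abbrev toHo : DiffProj.{u, w} R ⥤ HoDiffProj.{u, w} R := Quotient.functor _

instance : (toHo.{u, w} R).Additive := Quotient.functor_additive _ _

instance (n : ℤ) : (shiftFunctor (HoDiffProj.{u, w} R) n).Additive where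
  map_add {M N f g} := by
    obtain ⟨M⟩ := M
    obtain ⟨N⟩ := N
    obtain ⟨f, rfl⟩ := (toHo R).map_surjective f
    obtain ⟨g, rfl⟩ := (toHo R).map_surjective g
    have h (e : M ⟶ N) := ((toHo.{u, w} R).commShiftIso n).hom.naturality e
    have h' (e : M ⟶ N) : ((toHo.{u, w} R).map e)⟦n⟧' =
        ((toHo R).commShiftIso n).inv.app M ≫ (toHo R).map (e⟦n⟧') ≫
          ((toHo R).commShiftIso n).hom.app N := by
      have := h e
      dsimp only [Functor.comp_map] at this
      rw [this, Iso.inv_hom_id_app_assoc]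
    have hs : (f + g)⟦n⟧' = f⟦n⟧' + g⟦n⟧' := rfl
    rw [← Functor.map_add, h', h', h', hs, Functor.map_add, Preadditive.add_comp,
      Preadditive.comp_add]

instance : Limits.HasZeroObject (HoDiffProj.{u, w} R) where
  zero := by
    let Z : DiffProj.{u, w} R :=
      { carrier := PUnit
        projective := inferInstance
        d := 0
        d_comp_d := rfl }
    have h : 𝟙 Z = 0 := by ext1; rfl
    refine ⟨(toHo R).obj Z, ?_⟩
    rw [Limits.IsZero.iff_id_eq_zero]
    exact ((toHo R).map_id Z).symm.trans ((congrArg (toHo R).map h).trans ((toHo R).map_zero Z Z))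

variable {R}

/-- The mapping cone of `f : (M, d) → (N, δ)`: the module `M × N` with the differential
`(m, n) ↦ (-d m, f m + δ n)`. -/
def cone {M N : DiffProj.{u, w} R} (f : M ⟶ N) : DiffProj.{u, w} R where
  carrier := M.carrier × N.carrier
  projective := by
    have := M.projective
    have := N.projective
    infer_instance
  d := LinearMap.prod (-(M.d ∘ₗ LinearMap.fst R _ _))
    (f.map ∘ₗ LinearMap.fst R _ _ + N.d ∘ₗ LinearMap.snd R _ _)
  d_comp_d := by
    have hM (x) : M.d (M.d x) = 0 := LinearMap.congr_fun M.d_comp_d x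
    have hN (x) : N.d (N.d x) = 0 := LinearMap.congr_fun N.d_comp_d x
    have hf (x) : f.map (M.d x) = N.d (f.map x) := LinearMap.congr_fun f.comm x
    ext x <;> simp [hM, hN, hf]

/-- The inclusion `N → cone f`, `n ↦ (0, n)`. -/
def coneInr {M N : DiffProj.{u, w} R} (f : M ⟶ N) : N ⟶ cone f where
  map := LinearMap.inr R M.carrier N.carrier
  comm := by
    apply LinearMap.ext
    intro x
    change ((0 : M.carrier), N.d x) = (-(M.d 0), f.map 0 + N.d x)
    simp

/-- The projection `cone f → ΣM`, `(m, n) ↦ m`. -/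
def coneFst {M N : DiffProj.{u, w} R} (f : M ⟶ N) : cone f ⟶ M⟦(1 : ℤ)⟧ where
  map := LinearMap.fst R M.carrier N.carrier
  comm := by
    apply LinearMap.ext
    rintro ⟨x, y⟩
    change -(M.d x) = ((1 : ℤ).negOnePow : ℤ) • M.d x
    simp

/-- The triangle `M → N → cone f → ΣM` in the homotopy category. -/
def coneTriangle {M N : DiffProj.{u, w} R} (f : M ⟶ N) :
    Pretriangulated.Triangle (HoDiffProj.{u, w} R) :=
  Pretriangulated.Triangle.mk ((toHo R).map f) ((toHo R).map (coneInr f))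
    ((toHo R).map (coneFst f) ≫ ((toHo R).commShiftIso (1 : ℤ)).hom.app M)

variable (R) in
/-- The exact triangles of the homotopy category: the triangles isomorphic to a mapping cone
triangle. -/
def exactTriangles : Set (Pretriangulated.Triangle (HoDiffProj.{u, w} R)) :=
  {T | ∃ (M N : DiffProj.{u, w} R) (f : M ⟶ N), Nonempty (T ≅ coneTriangle f)}

end HoDiffProj

/-! ### Compactly generated categories -/

section Compact

open Limits

variable {C : Type u} [Category.{v} C] [Preadditive C]

open Classical in
/-- The natural map `∐ Hom(S, T_l) → Hom(S, ∐ T_l)`. -/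
def coproductComparison (S : C) {L : Type w} (T : L → C) [HasCoproduct T] :
    (⨁ l, (S ⟶ T l)) →+ (S ⟶ ∐ T) :=
  DirectSum.toAddMonoid fun l => Preadditive.rightComp S (Sigma.ι T l)

/-- `S` is compact if `∐ Hom(S, T_l) → Hom(S, ∐ T_l)` is bijective for every small family `T_l`
whose coproduct exists. -/
def IsCompactObj (S : C) : Prop :=
  ∀ (L : Type w) (T : L → C) [HasCoproduct T], Function.Bijective (coproductComparison S T)

variable [HasShift C ℤ]

/-- A small family `S_i` of objects is a compact generating set if every `S_i` is compact, and
`T ≅ 0` whenever `Hom(Σⁿ S_i, T) = 0` for all `i` and all `n ∈ ℤ`. -/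
structure IsCompactGeneratingSet {I : Type w} (S : I → C) : Prop where
  isZero : ∀ T : C, (∀ (i : I) (n : ℤ) (f : (S i)⟦n⟧ ⟶ T), f = 0) → IsZero T
  compact : ∀ i, IsCompactObj.{u, v, w} (S i)

/-- `S` is a compact generator if `{S}` is a compact generating set. -/
def IsCompactGenerator (S : C) : Prop :=
  IsCompactGeneratingSet.{u, v, w} fun _ : PUnit.{w + 1} => S

variable (C) in
/-- A category with shift is compactly generated if it has all small coproducts and a compact
generating set. -/
structure IsCompactlyGenerated : Prop where
  hasCoproducts : HasCoproducts.{w} C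
  exists_generatingSet : ∃ (I : Type w) (S : I → C), IsCompactGeneratingSet.{u, v, w} S

end Compact

/-! ### The compact generator -/

section Generator

variable (k : Type u) [Field k] (V : Type v) [Quiver.{w} V] [Fintype V]
  [∀ a b : V, Fintype (a ⟶ b)]

/-- The differential projective module `C = kQ/J² ⊗_{kQ_0} kQ^op` with the differential
`d(y ⊗ z) = ∑_α yα ⊗ α*z`. -/
def generator : DiffProj.{max u v w, max u v w} (RadSqZero k V) where
  carrier := GenCarrier k V
  projective := genCarrier_projective k V
  d := genDifferential k V
  d_comp_d := genDifferential_sq k V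

end Generator

end DiffProjSqZero

end

noncomputable section

namespace DiffProjSqZero

open DiffProj

/-! ### The triangulated structure of the homotopy category -/

section Triangulated

open Pretriangulated

variable {R : Type u} [Ring R]

/-! Let `𝔯` be the kernel of the augmentation `Λ → kQ_0`; it satisfies `𝔯² = 0` and `Λ/𝔯` is
semisimple. The heart of the proof is that evaluation at `1 ⊗ 1` identifies `Hom(C, T)` in the
homotopy category with the homology of `T/𝔯T`.

For projective `T`, an element of `e_b 𝔯T` is a sum `∑ α n_α` over the arrows `α` into `b`, with
`n_α ∈ e_{s(α)}T` unique modulo `𝔯T`. If `dm ∈ 𝔯T`, write `e_b dm = ∑ α n_α`; then `d² = 0` gives `∑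
α d(n_α) = 0`, so `d(n_α) ∈ 𝔯T` and the step can be repeated with `n_α`. The result is a family
`ρ(p)`, indexed by the paths of `Q^op`, with `dρ(p) = ∑ α ρ(α* p)`, which is the same as a map `C →
T`. An inhomogeneous version of the recursion produces a null homotopy of `f` whenever `f(1 ⊗ 1)` is
a boundary modulo `𝔯T`. Both cases are contained in `exists_solution` and yield `generator_lift` and
`generator_null`.

Compactness follows because an element of a direct sum has finitely many nonzero components
(`isCompactObj_of_eval`). For generation, suppose `T/𝔯T` is acyclic. Being semisimple, it is
contractible; the contraction lifts to `T` by projectivity, with an error of square zero that can be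
corrected (`isZero_of_acyclic_mod`). The triangulated structure rests on explicit homotopy
equivalences between iterated cones, and coproducts are direct sums of modules. -/

lemma DiffProj.d_d (M : DiffProj.{u, w} R) (x : M.carrier) : M.d (M.d x) = 0 :=
  LinearMap.congr_fun M.d_comp_d x

lemma DiffProj.map_d {M N : DiffProj.{u, w} R} (f : M ⟶ N) (x : M.carrier) :
    f.map (M.d x) = N.d (f.map x) :=
  LinearMap.congr_fun f.comm x

lemma toHo_map_eq_iff {M N : DiffProj.{u, w} R} (f g : M ⟶ N) :
    (toHo R).map f = (toHo R).map g ↔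
      ∃ r : M.carrier →ₗ[R] N.carrier, ∀ x, f.map x - g.map x = r (M.d x) + N.d (r x) := by
  rw [Quotient.functor_map_eq_iff]
  exact exists_congr fun r => LinearMap.ext_iff

lemma toHo_map_eq_zero_iff {M N : DiffProj.{u, w} R} (f : M ⟶ N) :
    (toHo R).map f = 0 ↔
      ∃ r : M.carrier →ₗ[R] N.carrier, ∀ x, f.map x = r (M.d x) + N.d (r x) := by
  rw [← Functor.map_zero, toHo_map_eq_iff]
  simp

lemma shift_one_d (M : DiffProj.{u, w} R) (x : M.carrier) :
    (M⟦(1 : ℤ)⟧).d x = -(M.d x) := by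
  change ((1 : ℤ).negOnePow : ℤ) • M.d x = _
  simp

lemma shift_neg_one_d (M : DiffProj.{u, w} R) (x : M.carrier) :
    (M⟦(-1 : ℤ)⟧).d x = -(M.d x) := by
  change ((-1 : ℤ).negOnePow : ℤ) • M.d x = _
  simp

lemma exactTriangles_of_iso {T T' : Triangle (HoDiffProj.{u, w} R)} (e : T ≅ T')
    (h : T' ∈ exactTriangles R) : T ∈ exactTriangles R := by
  obtain ⟨M, N, f, ⟨e'⟩⟩ := h
  exact ⟨M, N, f, ⟨e ≪≫ e'⟩⟩

/-- A triangle `M → N → Q → ΣM` is exact as soon as `Q` is homotopy equivalent to the cone. -/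
lemma mapTriangle_mem_exactTriangles {M N Q : DiffProj.{u, w} R} (f : M ⟶ N) (g : N ⟶ Q)
    (h : Q ⟶ M⟦(1 : ℤ)⟧) (p : cone f ⟶ Q) (i : Q ⟶ cone f)
    (ip : (toHo R).map (i ≫ p) = (toHo R).map (𝟙 Q))
    (pi : (toHo R).map (p ≫ i) = (toHo R).map (𝟙 (cone f)))
    (hg : (toHo R).map (coneInr f ≫ p) = (toHo R).map g)
    (hh : (toHo R).map (p ≫ h) = (toHo R).map (coneFst f)) :
    (toHo R).mapTriangle.obj (Triangle.mk f g h) ∈ exactTriangles R := by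
  refine ⟨M, N, f, ⟨Iso.symm (Triangle.isoMk _ _ (Iso.refl _) (Iso.refl _)
    { hom := (toHo R).map p
      inv := (toHo R).map i
      hom_inv_id := ((toHo R).map_comp p i).symm.trans (pi.trans ((toHo R).map_id _))
      inv_hom_id := ((toHo R).map_comp i p).symm.trans (ip.trans ((toHo R).map_id _)) } ?_ ?_ ?_)⟩⟩
  · exact (Category.comp_id _).trans (Category.id_comp _).symm
  · refine Eq.trans ?_ (Category.id_comp _).symm
    exact ((toHo R).map_comp _ _).symm.trans hg
  · change ((toHo R).map (coneFst f) ≫ ((toHo R).commShiftIso (1 : ℤ)).hom.app M) ≫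
      (𝟙 ((toHo R).obj M))⟦(1 : ℤ)⟧' =
        (toHo R).map p ≫ (toHo R).map h ≫ ((toHo R).commShiftIso (1 : ℤ)).hom.app M
    rw [CategoryTheory.Functor.map_id]
    refine (Category.comp_id _).trans ?_
    rw [← hh, (toHo R).map_comp, Category.assoc]

lemma contractibleTriangle_mem_exactTriangles (X : HoDiffProj.{u, w} R) :
    contractibleTriangle X ∈ exactTriangles R := by
  obtain ⟨M⟩ := X
  have hz : Limits.IsZero ((toHo R).obj (cone (𝟙 M))) := by
    rw [Limits.IsZero.iff_id_eq_zero, ← (toHo R).map_id, toHo_map_eq_zero_iff]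
    -- The standard contraction `(x, y) ↦ (y, 0)` of the cone of an identity.
    refine ⟨LinearMap.inl R M.carrier M.carrier ∘ₗ LinearMap.snd R M.carrier M.carrier, ?_⟩
    rintro ⟨x, y⟩
    have h : ((x, y) : M.carrier × M.carrier) = (x + M.d y, 0) + (-(M.d y), y + M.d 0) := by
      ext <;> simp
    exact h
  refine ⟨M, M, 𝟙 M, ⟨Triangle.isoMk _ _ (Iso.refl _) (Iso.refl _)
    ((Limits.isZero_zero _).iso hz) ?_ ?_ ?_⟩⟩
  · change 𝟙 _ ≫ 𝟙 _ = 𝟙 _ ≫ (toHo R).map (𝟙 M)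
    rw [(toHo R).map_id]
  · exact hz.eq_of_tgt _ _
  · exact (Limits.isZero_zero _).eq_of_src _ _

lemma exists_exactTriangle {X Y : HoDiffProj.{u, w} R} (f : X ⟶ Y) :
    ∃ (Z : HoDiffProj.{u, w} R) (g : Y ⟶ Z) (h : Z ⟶ X⟦(1 : ℤ)⟧),
      Triangle.mk f g h ∈ exactTriangles R := by
  obtain ⟨M⟩ := X
  obtain ⟨N⟩ := Y
  obtain ⟨f, rfl⟩ := (toHo R).map_surjective f
  exact ⟨_, _, _, M, N, f, ⟨Iso.refl _⟩⟩

/-- In the cone of `coneInr f`, which is `N × M × N`, the two copies of `N` cancel up to homotopy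
and leave `ΣM`. The cancelling homotopy is `(n, m, n') ↦ (-n', 0, 0)`. -/
lemma rotate_coneTriangle_mem {M N : DiffProj.{u, w} R} (f : M ⟶ N) :
    (coneTriangle f).rotate ∈ exactTriangles R := by
  refine exactTriangles_of_iso ((toHo R).mapTriangleRotateIso.app
    (Triangle.mk f (coneInr f) (coneFst f))) ?_
  let p : cone (coneInr f) ⟶ M⟦(1 : ℤ)⟧ :=
    ⟨LinearMap.fst R M.carrier N.carrier ∘ₗ
      LinearMap.snd R N.carrier (M.carrier × N.carrier), by
      apply LinearMap.ext
      rintro ⟨n, m, n'⟩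
      change 0 + -(M.d m) = (M⟦(1 : ℤ)⟧).d m
      rw [shift_one_d, zero_add]⟩
  -- The entry `-f m` is forced: the last coordinate of the differential of `(n, m, 0)` is `n + f
  -- m`, which has to vanish.
  let i : M⟦(1 : ℤ)⟧ ⟶ cone (coneInr f) :=
    ⟨LinearMap.prod (-f.map) (LinearMap.inl R M.carrier N.carrier), by
      apply LinearMap.ext
      intro (m : M.carrier)
      change (LinearMap.prod (-f.map) (LinearMap.inl R M.carrier N.carrier)) ((M⟦(1 : ℤ)⟧).d m) =
        (-(N.d (-f.map m)), (0, -f.map m) + (-(M.d m), f.map m + N.d 0))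
      rw [shift_one_d]
      simp [map_d]⟩
  refine mapTriangle_mem_exactTriangles (coneInr f) (coneFst f) (-f⟦(1 : ℤ)⟧') p i
    rfl ?_ rfl ?_
  · rw [toHo_map_eq_iff]
    refine ⟨-(LinearMap.inl R N.carrier (M.carrier × N.carrier) ∘ₗ
      LinearMap.snd R M.carrier N.carrier ∘ₗ
      LinearMap.snd R N.carrier (M.carrier × N.carrier)), ?_⟩
    rintro ⟨n, m, n'⟩
    change ((-f.map m, (m, (0 : N.carrier))) : N.carrier × M.carrier × N.carrier) - (n, (m, n')) =
      -(n + (f.map m + N.d n'), (0, 0)) +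
        (-(N.d (-n')), (0, -n') + (-(M.d (-0)), f.map (-0) + N.d (-0)))
    ext <;> simp
    abel
  · rw [toHo_map_eq_iff]
    refine ⟨-(LinearMap.snd R M.carrier N.carrier ∘ₗ
      LinearMap.snd R N.carrier (M.carrier × N.carrier)), ?_⟩
    rintro ⟨n, m, n'⟩
    refine Eq.trans ?_ (congrArg (fun z : N.carrier => -(n + (f.map m + N.d n')) + z)
      (shift_one_d N (-n')).symm)
    change -f.map m - n = -(n + (f.map m + N.d n')) + -(N.d (-n'))
    rw [map_neg]
    abel

/-- The cone of `Σ⁻¹ cone f → M`, `(m, n) ↦ -m`, is `(M × N) × M`. The two copies of `M` cancel,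
through the homotopy `((m, n), m') ↦ ((m', 0), 0)`, and leave `N`. -/
lemma invRotate_coneTriangle_mem {M N : DiffProj.{u, w} R} (f : M ⟶ N) :
    (coneTriangle f).invRotate ∈ exactTriangles R := by
  refine exactTriangles_of_iso ((toHo R).mapTriangleInvRotateIso.app
    (Triangle.mk f (coneInr f) (coneFst f))) ?_
  let g : (cone f)⟦(-1 : ℤ)⟧ ⟶ M := (Triangle.mk f (coneInr f) (coneFst f)).invRotate.mor₁
  let h : N ⟶ (cone f)⟦(-1 : ℤ)⟧⟦(1 : ℤ)⟧ := (Triangle.mk f (coneInr f) (coneFst f)).invRotate.mor₃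
  -- The shift by `-1` and the outer cone each negate the differential of `cone f`, so it reappears
  -- with its original sign.
  have hd (m : M.carrier) (n : N.carrier) (m' : M.carrier) :
      (cone g).d (show (M.carrier × N.carrier) × M.carrier from ((m, n), m')) =
        (show (M.carrier × N.carrier) × M.carrier from
          ((-(M.d m), f.map m + N.d n), -m + M.d m')) := by
    refine (congrArg (fun z : M.carrier × N.carrier => (-z, -m + M.d m'))
      (shift_neg_one_d (cone f) (m, n))).trans ?_
    change (-(-(-(M.d m), f.map m + N.d n)), -m + M.d m') = _
    rw [neg_neg]
  let p : cone g ⟶ N :=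
    ⟨LinearMap.coprod (LinearMap.snd R M.carrier N.carrier) f.map, by
      apply LinearMap.ext
      rintro ⟨⟨m, n⟩, m'⟩
      refine (congrArg (LinearMap.coprod (LinearMap.snd R M.carrier N.carrier) f.map)
        (hd m n m')).trans ?_
      change f.map m + N.d n + f.map (-m + M.d m') = N.d (n + f.map m')
      rw [map_add, map_add, map_d, map_neg]
      abel⟩
  let i : N ⟶ cone g :=
    ⟨LinearMap.inl R (M.carrier × N.carrier) M.carrier ∘ₗ LinearMap.inr R M.carrier N.carrier, by
      apply LinearMap.ext
      intro n
      refine Eq.trans ?_ (hd 0 n 0).symm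
      change ((0, N.d n), 0) = ((-(M.d 0), f.map 0 + N.d n), -0 + M.d 0)
      simp⟩
  refine mapTriangle_mem_exactTriangles g f h p i ?_ ?_ ?_ ?_
  · congr 1
    apply hom_ext
    apply LinearMap.ext
    intro n
    change n + f.map 0 = n
    simp
  · rw [toHo_map_eq_iff]
    refine ⟨LinearMap.inl R (M.carrier × N.carrier) M.carrier ∘ₗ
      LinearMap.inl R M.carrier N.carrier ∘ₗ LinearMap.snd R (M.carrier × N.carrier) M.carrier, ?_⟩
    rintro ⟨⟨m, n⟩, m'⟩
    refine Eq.trans ?_ (congrArg₂ (fun a b : (M.carrier × N.carrier) × M.carrier =>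
      ((a.2, (0 : N.carrier)), (0 : M.carrier)) + b) (hd m n m') (hd m' 0 0)).symm
    change (((0, n + f.map m'), 0) : (M.carrier × N.carrier) × M.carrier) - ((m, n), m') =
      ((-m + M.d m', 0), 0) + ((-(M.d m'), f.map m' + N.d 0), -m' + M.d 0)
    ext <;> simp
  · congr 1
    apply hom_ext
    apply LinearMap.ext
    intro m
    change 0 + f.map m = f.map m
    simp
  · rw [toHo_map_eq_iff]
    refine ⟨LinearMap.inl R M.carrier N.carrier ∘ₗ
      LinearMap.snd R (M.carrier × N.carrier) M.carrier, ?_⟩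
    rintro ⟨⟨m, n⟩, m'⟩
    have hs : (((cone f)⟦(-1 : ℤ)⟧)⟦(1 : ℤ)⟧).d (show M.carrier × N.carrier from (m', 0)) =
        (cone f).d (m', 0) :=
      ((shift_one_d ((cone f)⟦(-1 : ℤ)⟧) _).trans
        (congrArg (fun z : M.carrier × N.carrier => -z) (shift_neg_one_d (cone f) _))).trans
        (neg_neg (G := M.carrier × N.carrier) _)
    refine Eq.trans ?_ (congrArg₂ (fun (a : (M.carrier × N.carrier) × M.carrier)
      (b : M.carrier × N.carrier) => (a.2, (0 : N.carrier)) + b) (hd m n m') hs).symm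
    change ((0, n + f.map m') : M.carrier × N.carrier) - (m, n) =
      (-m + M.d m', 0) + (-(M.d m'), f.map m' + N.d 0)
    ext <;> simp

lemma rotate_mem_exactTriangles_iff (T : Triangle (HoDiffProj.{u, w} R)) :
    T ∈ exactTriangles R ↔ T.rotate ∈ exactTriangles R := by
  constructor
  · rintro ⟨M, N, f, ⟨e⟩⟩
    exact exactTriangles_of_iso ((rotate _).mapIso e) (rotate_coneTriangle_mem f)
  · rintro ⟨M, N, f, ⟨e⟩⟩
    exact exactTriangles_of_iso ((triangleRotation _).unitIso.app T ≪≫ (invRotate _).mapIso e)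
      (invRotate_coneTriangle_mem f)

/-- The square of representatives commutes only up to a homotopy `r`, and `r` serves as the
off-diagonal entry of the map of cones `(m, n) ↦ (a m, r m + b n)`. -/
lemma coneTriangle_morphism {M N M' N' : DiffProj.{u, w} R} (f : M ⟶ N) (f' : M' ⟶ N')
    (a : (toHo R).obj M ⟶ (toHo R).obj M') (b : (toHo R).obj N ⟶ (toHo R).obj N')
    (comm : (toHo R).map f ≫ b = a ≫ (toHo R).map f') :
    ∃ c : (toHo R).obj (cone f) ⟶ (toHo R).obj (cone f'),
      (coneTriangle f).mor₂ ≫ c = b ≫ (coneTriangle f').mor₂ ∧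
      (coneTriangle f).mor₃ ≫ a⟦(1 : ℤ)⟧' = c ≫ (coneTriangle f').mor₃ := by
  obtain ⟨a, rfl⟩ := (toHo R).map_surjective a
  obtain ⟨b, rfl⟩ := (toHo R).map_surjective b
  rw [← Functor.map_comp, ← Functor.map_comp, toHo_map_eq_iff] at comm
  obtain ⟨r, hr⟩ := comm
  have hr (x) : b.map (f.map x) - f'.map (a.map x) = r (M.d x) + N'.d (r x) := hr x
  let c : cone f ⟶ cone f' :=
    ⟨LinearMap.prod (a.map ∘ₗ LinearMap.fst R M.carrier N.carrier) (LinearMap.coprod r b.map), by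
      apply LinearMap.ext
      rintro ⟨m, n⟩
      change (a.map (-(M.d m)), r (-(M.d m)) + b.map (f.map m + N.d n)) =
        (-(M'.d (a.map m)), f'.map (a.map m) + N'.d (r m + b.map n))
      have := hr m
      rw [sub_eq_iff_eq_add] at this
      ext
      · simp [map_d]
      · simp only [map_add, map_neg, map_d, this]
        abel⟩
  refine ⟨(toHo R).map c, ?_, ?_⟩
  · change (toHo R).map (coneInr f) ≫ (toHo R).map c = (toHo R).map b ≫ (toHo R).map (coneInr f')
    rw [← Functor.map_comp, ← Functor.map_comp]
    congr 1
    ext n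
    change (a.map 0, r 0 + b.map n) = ((0, b.map n) : M'.carrier × N'.carrier)
    simp
  · change ((toHo R).map (coneFst f) ≫ ((toHo R).commShiftIso (1 : ℤ)).hom.app M) ≫
      ((toHo R).map a)⟦(1 : ℤ)⟧' =
      (toHo R).map c ≫ (toHo R).map (coneFst f') ≫ ((toHo R).commShiftIso (1 : ℤ)).hom.app M'
    have h := ((toHo.{u, w} R).commShiftIso (1 : ℤ)).hom.naturality a
    dsimp only [Functor.comp_map] at h
    rw [Category.assoc, ← h, ← Functor.map_comp_assoc, ← Functor.map_comp_assoc]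
    rfl

lemma exactTriangle_morphism (T₁ T₂ : Triangle (HoDiffProj.{u, w} R))
    (h₁ : T₁ ∈ exactTriangles R) (h₂ : T₂ ∈ exactTriangles R)
    (a : T₁.obj₁ ⟶ T₂.obj₁) (b : T₁.obj₂ ⟶ T₂.obj₂) (comm : T₁.mor₁ ≫ b = a ≫ T₂.mor₁) :
    ∃ c : T₁.obj₃ ⟶ T₂.obj₃,
      T₁.mor₂ ≫ c = b ≫ T₂.mor₂ ∧ T₁.mor₃ ≫ a⟦(1 : ℤ)⟧' = c ≫ T₂.mor₃ := by
  obtain ⟨M, N, f, ⟨e₁⟩⟩ := h₁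
  obtain ⟨M', N', f', ⟨e₂⟩⟩ := h₂
  obtain ⟨c, hc, hc'⟩ : ∃ c : (coneTriangle f).obj₃ ⟶ (coneTriangle f').obj₃,
      (coneTriangle f).mor₂ ≫ c =
        (e₁.inv.hom₂ ≫ b ≫ e₂.hom.hom₂) ≫ (coneTriangle f').mor₂ ∧
      (coneTriangle f).mor₃ ≫ (e₁.inv.hom₁ ≫ a ≫ e₂.hom.hom₁)⟦(1 : ℤ)⟧' =
        c ≫ (coneTriangle f').mor₃ := by
    refine coneTriangle_morphism f f' _ _ ?_
    have h : (coneTriangle f).mor₁ ≫ e₁.inv.hom₂ ≫ b ≫ e₂.hom.hom₂ =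
        (e₁.inv.hom₁ ≫ a ≫ e₂.hom.hom₁) ≫ (coneTriangle f').mor₁ := by
      rw [e₁.inv.comm₁_assoc, reassoc_of% comm, e₂.hom.comm₁, Category.assoc, Category.assoc]
    exact h
  refine ⟨e₁.hom.hom₃ ≫ c ≫ e₂.inv.hom₃, ?_, ?_⟩
  · rw [e₁.hom.comm₂_assoc, reassoc_of% hc, e₂.inv.comm₂]
    simp
  · rw [Category.assoc, Category.assoc, ← e₂.inv.comm₃, ← reassoc_of% hc',
      ← e₁.hom.comm₃_assoc, ← Functor.map_comp, ← Functor.map_comp]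
    congr 2
    simp

variable (R) in
/-- The pretriangulated structure given by the mapping cone triangles. -/
@[reducible]
def conePretriangulated : Pretriangulated (HoDiffProj.{u, w} R) where
  distinguishedTriangles := exactTriangles R
  isomorphic_distinguished _ h _ e := exactTriangles_of_iso e h
  contractible_distinguished := contractibleTriangle_mem_exactTriangles
  distinguished_cocone_triangle := exists_exactTriangle
  rotate_distinguished_triangle := rotate_mem_exactTriangles_iff
  complete_distinguished_triangle_morphism := exactTriangle_morphism

/-- The map of cones `cone f → cone (g f)`, `(x, y) ↦ (x, g y)`. -/
def coneMapRight {X Y Z : DiffProj.{u, w} R} (f : X ⟶ Y) (g : Y ⟶ Z) : cone f ⟶ cone (f ≫ g) where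
  map := LinearMap.prodMap LinearMap.id g.map
  comm := by
    apply LinearMap.ext
    rintro ⟨x, y⟩
    change (-(X.d x), g.map (f.map x + Y.d y)) = (-(X.d x), g.map (f.map x) + Z.d (g.map y))
    rw [map_add, map_d]

/-- The map of cones `cone (g f) → cone g`, `(x, z) ↦ (f x, z)`. -/
def coneMapLeft {X Y Z : DiffProj.{u, w} R} (f : X ⟶ Y) (g : Y ⟶ Z) : cone (f ≫ g) ⟶ cone g where
  map := LinearMap.prodMap f.map LinearMap.id
  comm := by
    apply LinearMap.ext
    rintro ⟨x, z⟩
    change (f.map (-(X.d x)), g.map (f.map x) + Z.d z) =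
      (-(Y.d (f.map x)), g.map (f.map x) + Z.d z)
    rw [map_neg, map_d]

/-- The octahedral axiom at the level of modules: in the cone of `cone f → cone (g f)` the two
copies of `X` cancel, leaving `Y × Z` with the differential of `cone g`. The retraction sends `((x,
y), (x', z))` to `(y + f x', z)`, and the homotopy moves `x'` to the place of `x` with a sign. -/
lemma cone_octahedral {X Y Z : DiffProj.{u, w} R} (f : X ⟶ Y) (g : Y ⟶ Z) :
    (toHo R).mapTriangle.obj (Triangle.mk (coneMapRight f g) (coneMapLeft f g)
      (coneFst g ≫ (coneInr f)⟦(1 : ℤ)⟧')) ∈ exactTriangles R := by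
  have hd (x : X.carrier) (y : Y.carrier) (x' : X.carrier) (z : Z.carrier) :
      (cone (coneMapRight f g)).d ((x, y), (x', z)) =
        ((X.d x, -(f.map x) - Y.d y), (x - X.d x', g.map y + (g.map (f.map x') + Z.d z))) := by
    change (-(-(X.d x), f.map x + Y.d y),
      ((x, g.map y) + (-(X.d x'), g.map (f.map x') + Z.d z) : X.carrier × Z.carrier)) = _
    ext <;> simp <;> abel
  let p : cone (coneMapRight f g) ⟶ cone g :=
    ⟨LinearMap.coprod (LinearMap.inl R Y.carrier Z.carrier ∘ₗ LinearMap.snd R X.carrier Y.carrier)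
      (LinearMap.prodMap f.map LinearMap.id), by
      apply LinearMap.ext
      rintro ⟨⟨x, y⟩, ⟨x', z⟩⟩
      refine (congrArg (LinearMap.coprod
        (LinearMap.inl R Y.carrier Z.carrier ∘ₗ LinearMap.snd R X.carrier Y.carrier)
        (LinearMap.prodMap f.map LinearMap.id)) (hd x y x' z)).trans ?_
      change ((-(f.map x) - Y.d y, 0) + (f.map (x - X.d x'), g.map y + (g.map (f.map x') + Z.d z)) :
        Y.carrier × Z.carrier) = (-(Y.d (y + f.map x')), g.map (y + f.map x') + Z.d (0 + z))
      ext <;> simp [map_d] <;> abel⟩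
  let i : cone g ⟶ cone (coneMapRight f g) :=
    ⟨LinearMap.prodMap (LinearMap.inr R X.carrier Y.carrier) (LinearMap.inr R X.carrier Z.carrier),
      by
      apply LinearMap.ext
      rintro ⟨y, z⟩
      change ((0, -(Y.d y)), (0, g.map y + Z.d z)) = (cone (coneMapRight f g)).d ((0, y), (0, z))
      rw [hd]
      simp⟩
  refine mapTriangle_mem_exactTriangles (coneMapRight f g) _ _ p i ?_ ?_ ?_ ?_
  · congr 1
    apply hom_ext
    apply LinearMap.ext
    rintro ⟨y, z⟩
    change ((y, 0) + (f.map 0, z) : Y.carrier × Z.carrier) = (y, z)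
    simp
  · rw [toHo_map_eq_iff]
    refine ⟨-(LinearMap.inl R (X.carrier × Y.carrier) (X.carrier × Z.carrier) ∘ₗ
      LinearMap.inl R X.carrier Y.carrier ∘ₗ LinearMap.fst R X.carrier Z.carrier ∘ₗ
      LinearMap.snd R (X.carrier × Y.carrier) (X.carrier × Z.carrier)), ?_⟩
    rintro ⟨⟨x, y⟩, ⟨x', z⟩⟩
    rw [hd]
    have h : (((0, y + f.map x'), (0, 0 + z)) :
      (X.carrier × Y.carrier) × (X.carrier × Z.carrier)) - ((x, y), (x', z)) =
      -((x - X.d x', 0), (0, 0)) + ((-(-(X.d (-x'))), -(f.map (-x') + Y.d (-0))),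
        ((-x', g.map (-0)) + (-(X.d (-0)), g.map (f.map (-0)) + Z.d (-0)))) := by
      ext <;> simp
      abel
    exact h
  · congr 1
    apply hom_ext
    apply LinearMap.ext
    rintro ⟨x, z⟩
    change ((0, 0) + (f.map x, z) : Y.carrier × Z.carrier) = (f.map x, z)
    simp
  · rw [toHo_map_eq_iff]
    refine ⟨-(LinearMap.inl R X.carrier Y.carrier ∘ₗ LinearMap.fst R X.carrier Z.carrier ∘ₗ
      LinearMap.snd R (X.carrier × Y.carrier) (X.carrier × Z.carrier)), ?_⟩
    rintro ⟨⟨x, y⟩, ⟨x', z⟩⟩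
    rw [hd]
    refine Eq.trans ?_ (congrArg (fun b : X.carrier × Y.carrier => -(x - X.d x', 0) + b)
      (shift_one_d (cone f) (-x', -0))).symm
    change ((0, y + f.map x') : X.carrier × Y.carrier) - (x, y) =
      -(x - X.d x', 0) + -(-(X.d (-x')), f.map (-x') + Y.d (-0))
    ext <;> simp
    abel

variable (R) in
-- Every composable pair of homotopy classes has strict representatives, and the octahedron need
-- only be checked for one choice of cones. For the mapping cones all four commutativities already
-- hold for the representing maps.
lemma conePretriangulated_isTriangulated :
    let _ := conePretriangulated.{u, w} R
    IsTriangulated (HoDiffProj.{u, w} R) := by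
  let _ := conePretriangulated.{u, w} R
  refine IsTriangulated.mk' ?_
  rintro ⟨X⟩ ⟨Y⟩ ⟨Z⟩ f g
  obtain ⟨f, rfl⟩ := (toHo R).map_surjective f
  obtain ⟨g, rfl⟩ := (toHo R).map_surjective g
  have hfg : (toHo R).map (f ≫ g) = (toHo R).map f ≫ (toHo R).map g := (toHo R).map_comp f g
  have hcone {M N : DiffProj.{u, w} R} (e : M ⟶ N) : coneTriangle e ∈ exactTriangles R :=
    ⟨M, N, e, ⟨Iso.refl _⟩⟩
  refine ⟨_, _, _, _, _, _, (toHo R).map f, (toHo R).map g, Iso.refl _, Iso.refl _, Iso.refl _,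
    (Category.comp_id _).trans (Category.id_comp _).symm,
    (Category.comp_id _).trans (Category.id_comp _).symm,
    _, _, hcone f, _, _, hcone g,
    (coneTriangle (f ≫ g)).mor₂, (coneTriangle (f ≫ g)).mor₃, ?_, ⟨?_⟩⟩
  · rw [← hfg]
    exact hcone (f ≫ g)
  · have hc := ((toHo.{u, w} R).commShiftIso (1 : ℤ)).hom.naturality f
    have hc' := ((toHo.{u, w} R).commShiftIso (1 : ℤ)).hom.naturality (coneInr f)
    dsimp only [Functor.comp_map] at hc hc'
    exact
      { m₁ := (toHo R).map (coneMapRight f g)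
        m₃ := (toHo R).map (coneMapLeft f g)
        comm₁ := by
          change (toHo R).map (coneInr f) ≫ (toHo R).map (coneMapRight f g) =
            (toHo R).map g ≫ (toHo R).map (coneInr (f ≫ g))
          rw [← Functor.map_comp, ← Functor.map_comp]
          rfl
        comm₂ := by
          change (toHo R).map (coneMapRight f g) ≫ (toHo R).map (coneFst (f ≫ g)) ≫ _ =
            (toHo R).map (coneFst f) ≫ _
          rw [← Functor.map_comp_assoc]
          rfl
        comm₃ := by
          change (toHo R).map (coneInr (f ≫ g)) ≫ (toHo R).map (coneMapLeft f g) =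
            (toHo R).map (coneInr g)
          rw [← Functor.map_comp]
          congr 1
          ext z
          change (f.map 0, z) = ((0, z) : Y.carrier × Z.carrier)
          simp
        comm₄ := by
          change ((toHo R).map (coneFst (f ≫ g)) ≫
            ((toHo R).commShiftIso (1 : ℤ)).hom.app X) ≫ ((toHo R).map f)⟦(1 : ℤ)⟧' =
            (toHo R).map (coneMapLeft f g) ≫ (toHo R).map (coneFst g) ≫
              ((toHo R).commShiftIso (1 : ℤ)).hom.app Y
          rw [Category.assoc, ← hc, ← Functor.map_comp_assoc, ← Functor.map_comp_assoc]
          rfl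
        mem := by
          have h := cone_octahedral f g
          have h3 : (toHo R).map (coneFst g ≫ (coneInr f)⟦(1 : ℤ)⟧') ≫
              ((toHo R).commShiftIso (1 : ℤ)).hom.app (cone f) =
              ((toHo R).map (coneFst g) ≫ ((toHo R).commShiftIso (1 : ℤ)).hom.app Y) ≫
                ((toHo R).map (coneInr f))⟦(1 : ℤ)⟧' := by
            rw [Category.assoc, ← hc', Functor.map_comp_assoc]
          change Triangle.mk _ _ ((toHo R).map (coneFst g ≫ (coneInr f)⟦(1 : ℤ)⟧') ≫
              ((toHo R).commShiftIso (1 : ℤ)).hom.app (cone f)) ∈ _ at h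
          rw [h3] at h
          exact h }

end Triangulated

/-! ### Coproducts in the homotopy category -/

section Coproducts

variable {R : Type u} [Ring R] {L : Type w}

/-- The direct sum of a family of differential projective modules. -/
def DiffProj.directSum (T : L → DiffProj.{u, w} R) : DiffProj.{u, w} R where
  carrier := ⨁ l, (T l).carrier
  projective := by
    have (l : L) := (T l).projective
    infer_instance
  d := DirectSum.lmap fun l => (T l).d
  d_comp_d := by
    rw [← DirectSum.lmap_comp]
    apply LinearMap.ext
    intro x
    refine DFinsupp.ext fun l => ?_
    exact d_d (T l) (x l)

open Classical in
/-- The inclusion of a summand. -/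
def directSumι (T : L → DiffProj.{u, w} R) (l : L) : T l ⟶ directSum T where
  map := DirectSum.lof R L (fun l => (T l).carrier) l
  comm := by
    apply LinearMap.ext
    intro x
    exact (DirectSum.lmap_lof (R := R) (fun l => (T l).d) l x).symm

open Classical in
/-- The map out of a direct sum given by maps out of the summands. -/
def directSumDesc (T : L → DiffProj.{u, w} R) {X : DiffProj.{u, w} R} (f : ∀ l, T l ⟶ X) :
    directSum T ⟶ X where
  map := DirectSum.toModule R L X.carrier fun l => (f l).map
  comm := by
    refine DirectSum.linearMap_ext (R := R) (ι := L) (M := fun l => (T l).carrier) fun l => ?_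
    apply LinearMap.ext
    intro x
    change DirectSum.toModule R L X.carrier (fun l => (f l).map)
      (DirectSum.lmap (fun l => (T l).d) (DirectSum.lof R L _ l x)) =
        X.d (DirectSum.toModule R L X.carrier (fun l => (f l).map) (DirectSum.lof R L _ l x))
    rw [DirectSum.lmap_lof, DirectSum.toModule_lof, DirectSum.toModule_lof, map_d]

lemma directSumι_desc (T : L → DiffProj.{u, w} R) {X : DiffProj.{u, w} R} (f : ∀ l, T l ⟶ X)
    (l : L) : directSumι T l ≫ directSumDesc T f = f l := by
  classical
  apply hom_ext
  apply LinearMap.ext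
  intro x
  exact DirectSum.toModule_lof (M := fun l => (T l).carrier) (φ := fun l => (f l).map) R l x

/-- Homotopies chosen on the summands assemble into one on the direct sum, since there is no
compatibility to satisfy. This is the uniqueness half of the universal property in the homotopy
category. -/
lemma toHo_directSum_hom_ext (T : L → DiffProj.{u, w} R) {X : DiffProj.{u, w} R}
    (f g : directSum T ⟶ X)
    (h : ∀ l, (toHo R).map (directSumι T l ≫ f) = (toHo R).map (directSumι T l ≫ g)) :
    (toHo R).map f = (toHo R).map g := by
  classical
  simp only [toHo_map_eq_iff] at h
  choose r hr using h
  rw [toHo_map_eq_iff]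
  let s : (⨁ l, (T l).carrier) →ₗ[R] X.carrier := DirectSum.toModule R L X.carrier r
  have key : f.map - g.map = (show (directSum T).carrier →ₗ[R] X.carrier from
      s ∘ₗ (directSum T).d + (show (directSum T).carrier →ₗ[R] X.carrier from X.d ∘ₗ s)) := by
    refine DirectSum.linearMap_ext (R := R) (ι := L) (M := fun l => (T l).carrier) fun l => ?_
    apply LinearMap.ext
    intro x
    refine (hr l x).trans ?_
    change _ = s (DirectSum.lmap (fun l => (T l).d) (DirectSum.lof R L _ l x)) +
      X.d (s (DirectSum.lof R L _ l x))
    rw [DirectSum.lmap_lof, DirectSum.toModule_lof, DirectSum.toModule_lof]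
  exact ⟨s, LinearMap.congr_fun key⟩

/-- The direct sum as a cofan in the homotopy category. -/
def directSumCofan (T : L → HoDiffProj.{u, w} R) : Limits.Cofan T :=
  Limits.Cofan.mk ((toHo R).obj (directSum fun l => (T l).as))
    fun l => (toHo R).map (directSumι (fun l => (T l).as) l)

/-- The direct sum is a coproduct in the homotopy category. -/
def directSumCofanIsColimit (T : L → HoDiffProj.{u, w} R) :
    Limits.IsColimit (directSumCofan T) :=
  Limits.Cofan.IsColimit.mk _
    (fun c => (toHo R).map (directSumDesc (X := c.pt.as) (fun l => (T l).as)
      fun l => (toHo R).preimage (X := (T l).as) (Y := c.pt.as) (c.inj l)))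
    (fun c l => by
      refine ((toHo R).map_comp _ _).symm.trans ?_
      rw [directSumι_desc]
      exact (toHo R).map_preimage _)
    (fun c m hm => by
      obtain ⟨m, rfl⟩ := (toHo R).map_surjective (X := directSum fun l => (T l).as)
        (Y := c.pt.as) m
      refine toHo_directSum_hom_ext _ _ _ fun l => ?_
      rw [directSumι_desc, (toHo R).map_preimage, (toHo R).map_comp]
      exact hm l)

lemma hasCoproducts_hoDiffProj : Limits.HasCoproducts.{w} (HoDiffProj.{u, w} R) :=
  Limits.hasCoproducts_of_colimit_cofans directSumCofan directSumCofanIsColimit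

end Coproducts

/-! ### Injectivity of the coproduct comparison map -/

open Classical in
lemma coproductComparison_of {C : Type u} [Category.{v} C] [Preadditive C] (S : C)
    {L : Type w} (T : L → C) [Limits.HasCoproduct T] (l : L) (f : S ⟶ T l) :
    coproductComparison S T (DirectSum.of _ l f) = f ≫ Limits.Sigma.ι T l :=
  DirectSum.toAddMonoid_of (fun l => Preadditive.rightComp S (Limits.Sigma.ι T l)) l f

/-- Composing with the projections `Sigma.π` recovers every component. Hence compactness of an
object is only a matter of surjectivity. -/
lemma coproductComparison_injective {C : Type u} [Category.{v} C] [Preadditive C] (S : C)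
    {L : Type w} (T : L → C) [Limits.HasCoproduct T] :
    Function.Injective (coproductComparison S T) := by
  classical
  have key (x : ⨁ l, (S ⟶ T l)) (l : L) :
      coproductComparison S T x ≫ Limits.Sigma.π T l = x l := by
    induction x using DirectSum.induction_on with
    | zero => rw [map_zero, Limits.zero_comp]; rfl
    | add x y hx hy => rw [map_add, Preadditive.add_comp, hx, hy]; rfl
    | of i f =>
      rw [coproductComparison_of, Category.assoc]
      by_cases h : i = l
      · subst h
        rw [Limits.Sigma.ι_π_eq_id, Category.comp_id, DirectSum.of_eq_same]
      · rw [Limits.Sigma.ι_π_of_ne _ h, Limits.comp_zero, DirectSum.of_eq_of_ne _ _ _ (Ne.symm h)]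
  intro x y h
  refine DFinsupp.ext fun l => ?_
  rw [← key x l, ← key y l, h]

/-! ### Detecting compactness and contractibility modulo an ideal -/

section Radical

variable {R : Type u} [Ring R] (J : Ideal R)

lemma map_mem_smul_top {M N : Type*} [AddCommGroup M] [AddCommGroup N] [Module R M] [Module R N]
    (f : M →ₗ[R] N) {x : M} (hx : x ∈ J • (⊤ : Submodule R M)) :
    f x ∈ J • (⊤ : Submodule R N) := by
  have h := Submodule.mem_map_of_mem (f := f) hx
  rw [Submodule.map_smul''] at h
  exact Submodule.smul_mono le_rfl le_top h

/-- If the maps out of `S` correspond, up to homotopy, to the cycles modulo `J` via the evaluation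
at an element `c`, then `S` is compact. -/
theorem isCompactObj_of_eval {S : DiffProj.{u, w} R} {c : S.carrier}
    (hc : S.d c ∈ J • (⊤ : Submodule R S.carrier))
    (lift : ∀ (T : DiffProj.{u, w} R) (m : T.carrier), T.d m ∈ J • (⊤ : Submodule R T.carrier) →
      ∃ f : S ⟶ T, f.map c = m)
    (null : ∀ (T : DiffProj.{u, w} R) (f : S ⟶ T) (y : T.carrier),
      f.map c - T.d y ∈ J • (⊤ : Submodule R T.carrier) → (toHo R).map f = 0) :
    IsCompactObj.{max u (w + 1), w, w} ((toHo R).obj S) := by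
  classical
  intro L T _
  refine ⟨coproductComparison_injective _ _, fun g => ?_⟩
  let D := directSum fun l => (T l).as
  -- The coproduct in the definition of compactness is an arbitrary one, so it is first replaced by
  -- the explicit direct sum.
  let e : ∐ T ≅ (directSumCofan T).pt :=
    (Limits.coproductIsCoproduct T).coconePointUniqueUpToIso (directSumCofanIsColimit T)
  have he (l : L) : Limits.Sigma.ι T l ≫ e.hom =
      (toHo R).map (directSumι (fun l => (T l).as) l) :=
    Limits.IsColimit.comp_coconePointUniqueUpToIso_hom (Limits.coproductIsCoproduct T)
      (directSumCofanIsColimit T) ⟨l⟩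
  obtain ⟨f, hf⟩ := (toHo R).map_surjective (X := S) (Y := D) (g ≫ e.hom)
  -- Finiteness enters here: `f(c)` lies in a direct sum, so only the lifts of its finitely many
  -- nonzero components are needed.
  let m : ⨁ l, (T l).as.carrier := f.map c
  have hm (l : L) : (T l).as.d (m l) ∈ J • (⊤ : Submodule R (T l).as.carrier) := by
    have h := map_mem_smul_top J (DirectSum.component R L (fun l => (T l).as.carrier) l ∘ₗ f.map) hc
    have h' : (DirectSum.component R L (fun l => (T l).as.carrier) l ∘ₗ f.map) (S.d c) =
        (T l).as.d (m l) :=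
      congrArg (DirectSum.component R L (fun l => (T l).as.carrier) l) (map_d f c)
    exact h' ▸ h
  choose F hF using fun l => lift _ _ (hm l)
  refine ⟨∑ l ∈ DFinsupp.support m, DirectSum.of (fun l => (toHo R).obj S ⟶ T l) l
    ((toHo R).map (F l)), ?_⟩
  refine (cancel_mono e.hom).1 (Eq.trans ?_ hf)
  have hsum : coproductComparison ((toHo R).obj S) T (∑ l ∈ DFinsupp.support m,
      DirectSum.of (fun l => (toHo R).obj S ⟶ T l) l ((toHo R).map (F l))) ≫ e.hom =
      (toHo R).map (∑ l ∈ DFinsupp.support m, F l ≫ directSumι (fun l => (T l).as) l) := by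
    rw [map_sum, Preadditive.sum_comp, (toHo R).map_sum]
    refine Finset.sum_congr rfl fun l _ => ?_
    rw [(toHo R).map_comp]
    refine Eq.trans ?_ (congrArg (fun z => (toHo R).map (F l) ≫ z) (he l))
    refine Eq.trans ?_ (Category.assoc _ _ _)
    congr 1
    exact coproductComparison_of _ _ _ _
  -- The finite sum and `f` take the same value at `c`, so `null` applies to their difference with
  -- `y = 0`.
  refine hsum.trans (sub_eq_zero.1 (((toHo R).map_sub).symm.trans (null D _ 0 ?_)))
  have hmap (s : Finset L) : (∑ l ∈ s, F l ≫ directSumι (fun l => (T l).as) l).map =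
      ∑ l ∈ s, (F l ≫ directSumι (fun l => (T l).as) l).map :=
    map_sum (AddMonoidHom.mk' (fun f : S ⟶ D => f.map) fun _ _ => rfl) _ _
  have hval : (∑ l ∈ DFinsupp.support m, F l ≫ directSumι (fun l => (T l).as) l).map c = m := by
    rw [hmap, LinearMap.sum_apply]
    refine Eq.trans (Finset.sum_congr rfl fun l _ => ?_) (DirectSum.sum_support_of m)
    change DirectSum.lof R L (fun l => (T l).as.carrier) l ((F l).map c) = _
    rw [hF]
    rfl
  rw [sub_map, LinearMap.sub_apply, hval, map_zero, sub_zero]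
  have h : f.map c - f.map c ∈ J • (⊤ : Submodule R D.carrier) := by
    rw [sub_self]
    exact Submodule.zero_mem _
  exact h

/-- A differential projective module is contractible as soon as it is acyclic modulo a two-sided
ideal of square zero with semisimple quotient. -/
theorem isZero_of_acyclic_mod [J.IsTwoSided] [IsSemisimpleRing (R ⧸ J)]
    (hJ : ∀ x ∈ J, ∀ y ∈ J, x * y = 0) {M : DiffProj.{u, w} R}
    (acyclic : ∀ m, M.d m ∈ J • (⊤ : Submodule R M.carrier) →
      ∃ y, m - M.d y ∈ J • (⊤ : Submodule R M.carrier)) :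
    Limits.IsZero ((toHo R).obj M) := by
  let P : Submodule R M.carrier := J • ⊤
  have : IsSemisimpleModule R (M.carrier ⧸ P) :=
    (Module.isTorsionBySet_quotient_ideal_smul M.carrier J).isSemisimpleModule_iff.1
      inferInstance
  let δ : (M.carrier ⧸ P) →ₗ[R] (M.carrier ⧸ P) :=
    P.mapQ P M.d fun x hx => map_mem_smul_top J M.d hx
  have hδ (x) : δ (P.mkQ x) = P.mkQ (M.d x) := rfl
  have hδδ (x) : δ (δ x) = 0 := by
    obtain ⟨x, rfl⟩ := P.mkQ_surjective x
    rw [hδ, hδ, d_d, map_zero]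
  -- Contraction of `M/JM`: semisimplicity gives a section `s` of `δ` over its image. The map `q = 1
  -- - sδ` takes values in cycles, hence in boundaries by acyclicity, and `η = s q` satisfies `ηδ +
  -- δη = 1`.
  obtain ⟨s, hs⟩ := IsSemisimpleModule.lifting_property δ.rangeRestrict
    δ.surjective_rangeRestrict LinearMap.id
  have hs (x) : δ (s x) = x := congrArg Subtype.val (LinearMap.congr_fun hs x)
  let q : (M.carrier ⧸ P) →ₗ[R] (M.carrier ⧸ P) := LinearMap.id - s ∘ₗ δ.rangeRestrict
  have hmem (x) : q x ∈ LinearMap.range δ := by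
    have h0 : δ (q x) = 0 := by
      simp [q, hs]
    obtain ⟨m, hm⟩ := P.mkQ_surjective (q x)
    rw [← hm] at h0 ⊢
    obtain ⟨y, hy⟩ := acyclic m ((Submodule.Quotient.mk_eq_zero P).1 h0)
    exact ⟨P.mkQ y, ((Submodule.Quotient.eq P).2 hy).symm⟩
  let η : (M.carrier ⧸ P) →ₗ[R] (M.carrier ⧸ P) := s ∘ₗ LinearMap.codRestrict _ q hmem
  have hη (x) : η (δ x) + δ (η x) = x := by
    have h1 : δ (η x) = x - s (δ.rangeRestrict x) := hs _
    have h2 : η (δ x) = s (δ.rangeRestrict x) := by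
      change s _ = _
      congr 1
      ext1
      change δ x - s (δ.rangeRestrict (δ x)) = δ x
      have : δ.rangeRestrict (δ x) = 0 := Subtype.ext (hδδ x)
      rw [this, map_zero, sub_zero]
    rw [h1, h2]
    abel
  have := M.projective
  obtain ⟨h, hh⟩ := Module.projective_lifting_property P.mkQ (η ∘ₗ P.mkQ) P.mkQ_surjective
  have hh (x) : P.mkQ (h x) = η (P.mkQ x) := LinearMap.congr_fun hh x
  -- The error of the lifted contraction. It maps `M` into `JM` by the choice of `h`, and it kills
  -- `JM` because `J² = 0`; hence `n² = 0`.
  let n : M.carrier →ₗ[R] M.carrier := h ∘ₗ M.d + M.d ∘ₗ h - LinearMap.id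
  have hn (x) : n x = h (M.d x) + M.d (h x) - x := rfl
  have hnP (x) : n x ∈ P := by
    rw [← Submodule.Quotient.mk_eq_zero]
    change P.mkQ (n x) = 0
    rw [hn, map_sub, map_add, hh, ← hδ, ← hδ, hh, hη, sub_self]
  have hJP (j : R) (hj : j ∈ J) (x : M.carrier) (hx : x ∈ P) : j • x = 0 := by
    induction hx using Submodule.smul_induction_on' with
    | smul i hi y _ => rw [smul_smul, hJ j hj i hi, zero_smul]
    | add x _ y _ hx hy => rw [smul_add, hx, hy, add_zero]
  have hnP0 (x) (hx : x ∈ P) : n x = 0 := by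
    induction hx using Submodule.smul_induction_on' with
    | smul i hi y _ => rw [map_smul, hJP i hi _ (hnP y)]
    | add x _ y _ hx hy => rw [map_add, hx, hy, add_zero]
  have hnn (x) : n (n x) = 0 := hnP0 _ (hnP x)
  have hnd (x) : n (M.d x) = M.d (n x) := by
    simp [hn, d_d]
  rw [Limits.IsZero.iff_id_eq_zero, ← (toHo R).map_id, toHo_map_eq_zero_iff]
  -- Multiply `hd + dh = 1 + n` by `1 - n`, the inverse of `1 + n`; since `n` commutes with `d`, the
  -- map `(1 - n)h` is a contraction.
  refine ⟨h - n ∘ₗ h, fun x => ?_⟩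
  have h1 : h (M.d x) + M.d (h x) = x + n x := by rw [hn]; abel
  have h2 : n (h (M.d x)) + n (M.d (h x)) = n x := by
    rw [← map_add, h1, map_add, hnn, add_zero]
  change x = (h (M.d x) - n (h (M.d x))) + M.d (h x - n (h x))
  rw [map_sub, ← hnd]
  rw [← eq_sub_iff_add_eq] at h1 h2
  rw [h2, h1]
  abel

/-- The evaluation criterion for a compact generator, for a two-sided ideal of square zero with
semisimple quotient. -/
theorem isCompactGenerator_of_eval [J.IsTwoSided] [IsSemisimpleRing (R ⧸ J)]
    (hJ : ∀ x ∈ J, ∀ y ∈ J, x * y = 0) {S : DiffProj.{u, w} R} {c : S.carrier}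
    (hc : S.d c ∈ J • (⊤ : Submodule R S.carrier))
    (lift : ∀ (T : DiffProj.{u, w} R) (m : T.carrier), T.d m ∈ J • (⊤ : Submodule R T.carrier) →
      ∃ f : S ⟶ T, f.map c = m)
    (null : ∀ (T : DiffProj.{u, w} R) (f : S ⟶ T) (y : T.carrier),
      f.map c - T.d y ∈ J • (⊤ : Submodule R T.carrier) → (toHo R).map f = 0) :
    IsCompactGenerator.{max u (w + 1), w, w} ((toHo R).obj S) where
  compact _ := isCompactObj_of_eval J hc lift null
  isZero T hT := by
    obtain ⟨M⟩ := T
    refine isZero_of_acyclic_mod J hJ fun m hm => ?_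
    obtain ⟨f, rfl⟩ := lift M m hm
    -- The shift `n = 0` alone suffices: the homology of `M/JM` carries no grading.
    have hf : (toHo R).map f = 0 := by
      have h := hT PUnit.unit 0 ((shiftFunctorZero (HoDiffProj.{u, w} R) ℤ).hom.app _ ≫
        (toHo R).map f)
      exact (Preadditive.IsIso.comp_left_eq_zero _ _).1 h
    obtain ⟨r, hr⟩ := (toHo_map_eq_zero_iff f).1 hf
    refine ⟨r c, ?_⟩
    rw [hr, add_sub_cancel_right]
    exact map_mem_smul_top J r hc

end Radical

/-! ### Coefficients of elements of `kQ/J²` -/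

section Coefficients

variable {k : Type u} [Field k] {V : Type v} [Quiver.{w} V]

/-- The length of a path. -/
def TotalPath.length (p : TotalPath V) : ℕ := p.2.2.length

lemma TotalPath.length_eq_zero_iff (p : TotalPath V) : p.length = 0 ↔ ∃ i, p = trivialPath i := by
  constructor
  · obtain ⟨a, b, p⟩ := p
    intro h
    cases p with
    | nil => exact ⟨a, rfl⟩
    | cons p e => simp [length] at h
  · rintro ⟨i, rfl⟩
    rfl

lemma trivialPath_injective : Function.Injective (trivialPath (V := V)) :=
  fun _ _ h => congrArg Sigma.fst h

lemma arrowPath_injective {a b : V} : Function.Injective (arrowPath : (a ⟶ b) → TotalPath V) := by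
  intro α β h
  have h1 := eq_of_heq (Sigma.mk.inj (eq_of_heq (Sigma.mk.inj h).2)).2
  exact eq_of_heq (Quiver.Path.cons.inj h1).2.2

/-- Lengths add under concatenation, so the coefficients of a product at paths of length at most one
see only short factors. -/
lemma mulSingle_apply_of_length_lt (p q r : TotalPath V) (c d : k)
    (h : r.length < p.length + q.length) : mulSingle p c q d r = 0 := by
  unfold mulSingle
  split_ifs with hpq
  · refine Finsupp.single_eq_of_ne ?_
    rintro rfl
    obtain ⟨a, b, p⟩ := p
    obtain ⟨a', b', q⟩ := q
    obtain rfl : b' = a := hpq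
    simp [TotalPath.length, Nat.add_comm] at h
  · rfl

lemma pathMul_apply_trivialPath (x y : TotalPath V →₀ k) (i : V) :
    pathMul x y (trivialPath i) = x (trivialPath i) * y (trivialPath i) := by
  classical
  induction x using Finsupp.induction_linear with
  | zero => simp [zero_pathMul]
  | add x x' h h' => simp [add_pathMul, h, h', add_mul]
  | single p c =>
    induction y using Finsupp.induction_linear with
    | zero => simp [pathMul_zero]
    | add y y' h h' => simp [pathMul_add, h, h', mul_add]
    | single q d =>
      by_cases hp : p.length = 0
      · obtain ⟨j, rfl⟩ := p.length_eq_zero_iff.1 hp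
        rw [trivial_pathMul_single]
        by_cases hq : q = trivialPath i
        · subst hq
          have hj : (trivialPath i).2.1 = j ↔ trivialPath j = trivialPath i :=
            ⟨fun h => by rw [← h]; rfl, fun h => (trivialPath_injective h).symm⟩
          by_cases h : trivialPath j = trivialPath i
          · rw [if_pos (hj.2 h), h]
            simp
          · rw [if_neg (h ∘ hj.1)]
            simp [h]
        · split_ifs <;> simp [Finsupp.single_apply, hq]
      · have hp' : p ≠ trivialPath i := fun h => hp (p.length_eq_zero_iff.2 ⟨i, h⟩)
        rw [pathMul_single, mulSingle_apply_of_length_lt]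
        · simp [Finsupp.single_apply, hp']
        · change 0 < _
          omega

/-- The only factorizations of an arrow `α : a → b` are `e_b α` and `α e_a`. This product rule
drives all later computations with coefficients. -/
lemma pathMul_apply_arrowPath (x y : TotalPath V →₀ k) {a b : V} (α : a ⟶ b) :
    pathMul x y (arrowPath α) =
      x (trivialPath b) * y (arrowPath α) + x (arrowPath α) * y (trivialPath a) := by
  classical
  induction x using Finsupp.induction_linear with
  | zero => simp [zero_pathMul]
  | add x x' h h' => simp only [add_pathMul, h, h', Finsupp.add_apply]; ring
  | single p c =>
    induction y using Finsupp.induction_linear with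
    | zero => simp [pathMul_zero]
    | add y y' h h' => simp only [pathMul_add, h, h', Finsupp.add_apply]; ring
    | single q d =>
      have hα (i : V) : trivialPath i ≠ arrowPath α := fun h => by
        simpa [TotalPath.length, trivialPath, arrowPath] using congrArg TotalPath.length h
      by_cases hp : p.length = 0
      · obtain ⟨j, rfl⟩ := p.length_eq_zero_iff.1 hp
        rw [trivial_pathMul_single, Finsupp.single_eq_of_ne (hα j).symm, zero_mul, add_zero]
        by_cases hq : q = arrowPath α
        · subst hq
          by_cases h : b = j
          · subst h
            rw [if_pos (by rfl)]
            simp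
          · rw [if_neg (by exact h), Finsupp.single_eq_of_ne fun h' => h (trivialPath_injective h')]
            simp
        · split_ifs <;> simp [Finsupp.single_apply, hq]
      · have hp' (i : V) : p ≠ trivialPath i := fun h => hp (p.length_eq_zero_iff.2 ⟨i, h⟩)
        rw [Finsupp.single_eq_of_ne (hp' b).symm, zero_mul, zero_add]
        by_cases hq : q.length = 0
        · obtain ⟨j, rfl⟩ := q.length_eq_zero_iff.1 hq
          rw [pathMul_single_trivial]
          by_cases hp : p = arrowPath α
          · subst hp
            by_cases h : j = a
            · subst h
              rw [if_pos (by rfl)]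
              simp
            · rw [if_neg (by exact h), Finsupp.single_eq_of_ne fun h' => h (trivialPath_injective h').symm]
              simp
          · split_ifs <;> simp [Finsupp.single_apply, hp]
        · have hq' : q ≠ trivialPath a := fun h => hq (q.length_eq_zero_iff.2 ⟨a, h⟩)
          rw [Finsupp.single_eq_of_ne hq'.symm, mul_zero, pathMul_single,
            mulSingle_apply_of_length_lt]
          change 1 < _
          omega

lemma PathAlgebra.induction_single {P : PathAlgebra k V → Prop} (x : PathAlgebra k V) (zero : P 0)
    (add : ∀ x y, P x → P y → P (x + y))
    (single : ∀ p c, P (show PathAlgebra k V from Finsupp.single p c)) : P x :=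
  Finsupp.induction_linear (motive := P) x zero add single

variable [Fintype V]

lemma vertexSum_apply_trivialPath (c : V → k) (i : V) : vertexSum c (trivialPath i) = c i := by
  classical
  rw [vertexSum, Finsupp.finsetSum_apply]
  simp [Finsupp.single_apply, trivialPath_injective.eq_iff]

namespace PathAlgebra

variable (k V) in
/-- The augmentation `kQ → kQ_0`. -/
def vertexCoeff : PathAlgebra k V →+* (V → k) where
  toFun x i := (show TotalPath V →₀ k from x) (trivialPath i)
  map_zero' := rfl
  map_one' := funext fun i => vertexSum_apply_trivialPath 1 i
  map_add' _ _ := rfl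
  map_mul' x y := funext fun i => pathMul_apply_trivialPath x y i

/-- The coefficient of an arrow. -/
def arrowCoeff {a b : V} (α : a ⟶ b) : PathAlgebra k V →+ k where
  toFun x := (show TotalPath V →₀ k from x) (arrowPath α)
  map_zero' := rfl
  map_add' _ _ := rfl

lemma arrowCoeff_mul {a b : V} (α : a ⟶ b) (x y : PathAlgebra k V) :
    arrowCoeff α (x * y) =
      vertexCoeff k V x b * arrowCoeff α y + arrowCoeff α x * vertexCoeff k V y a :=
  pathMul_apply_arrowPath x y α

lemma vertexCoeff_vertexHom (c : V → k) : vertexCoeff k V (vertexHom c) = c :=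
  funext fun i => vertexSum_apply_trivialPath c i

lemma vertexCoeff_arrow {a b : V} (α : a ⟶ b) : vertexCoeff k V (arrow α) = 0 :=
  funext fun i => Finsupp.single_eq_of_ne fun h => by
    simpa [TotalPath.length, trivialPath, arrowPath] using congrArg TotalPath.length h

lemma vertexCoeff_of_mem_arrowIdeal {x : PathAlgebra k V} (hx : x ∈ arrowIdeal k V) :
    vertexCoeff k V x = 0 := by
  have h : TwoSidedIdeal.span {x : PathAlgebra k V |
      ∃ (a b : V) (α : a ⟶ b), x = PathAlgebra.arrow α} ≤ TwoSidedIdeal.ker (vertexCoeff k V) := by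
    rw [TwoSidedIdeal.span_le]
    rintro _ ⟨a, b, α, rfl⟩
    exact (TwoSidedIdeal.mem_ker _).2 (vertexCoeff_arrow α)
  exact (TwoSidedIdeal.mem_ker _).1 (h (TwoSidedIdeal.mem_asIdeal.1 hx))

/-- Vertex coefficients vanish on `J`, and each term of the product rule contains one. Hence vertex
and arrow coefficients descend to `kQ/J²`. -/
lemma coeff_of_mem_arrowIdeal_sq {x : PathAlgebra k V} (hx : x ∈ arrowIdeal k V ^ 2) :
    vertexCoeff k V x = 0 ∧ ∀ (a b : V) (α : a ⟶ b), arrowCoeff α x = 0 := by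
  rw [Submodule.pow_succ, Submodule.pow_one] at hx
  induction hx using Submodule.mul_induction_on' with
  | mem_mul_mem x hx y hy =>
    have hx := vertexCoeff_of_mem_arrowIdeal hx
    have hy := vertexCoeff_of_mem_arrowIdeal hy
    refine ⟨by rw [map_mul, hx, zero_mul], fun a b α => ?_⟩
    rw [arrowCoeff_mul, hx, hy]
    simp
  | add x _ y _ hx hy =>
    refine ⟨by rw [map_add, hx.1, hy.1, add_zero], fun a b α => ?_⟩
    rw [map_add, hx.2, hy.2, add_zero]

/-- The last two arrows of the path split off as left factors, so the path lies in `J · J`. -/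
lemma single_mem_arrowIdeal_sq (p : TotalPath V) (c : k) (hp : 2 ≤ p.length) :
    (show PathAlgebra k V from Finsupp.single p c) ∈ arrowIdeal k V ^ 2 := by
  obtain ⟨a, b, p⟩ := p
  cases p with
  | nil => simp [TotalPath.length] at hp
  | cons p f =>
    cases p with
    | nil => simp [TotalPath.length] at hp
    | cons p e =>
      have h : (show PathAlgebra k V from Finsupp.single ⟨a, b, (p.cons e).cons f⟩ c) =
          arrow f * (arrow e * (show PathAlgebra k V from Finsupp.single ⟨_, _, p⟩ c)) := by
        change Finsupp.single _ _ = pathMul (Finsupp.single _ _)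
          (pathMul (Finsupp.single _ _) (Finsupp.single _ _))
        rw [pathMul_single (arrowPath e), mulSingle, dif_pos (by rfl), pathMul_single, mulSingle,
          dif_pos (by rfl), one_mul, one_mul]
        rfl
      rw [h, ← mul_assoc, Submodule.pow_succ, Submodule.pow_one]
      exact Ideal.mul_mem_right _ _ (Ideal.mul_mem_mul (arrow_mem f) (arrow_mem e))

/-- Once these coefficients vanish, only paths of length at least two remain in the support. So
vertices and arrows give a faithful set of coordinates on `kQ/J²`. -/
lemma mem_arrowIdeal_sq {x : PathAlgebra k V} (h0 : vertexCoeff k V x = 0)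
    (h1 : ∀ (a b : V) (α : a ⟶ b), arrowCoeff α x = 0) : x ∈ arrowIdeal k V ^ 2 := by
  have hx : x = ∑ p ∈ Finsupp.support (show TotalPath V →₀ k from x),
      (show PathAlgebra k V from Finsupp.single p ((show TotalPath V →₀ k from x) p)) :=
    (Finsupp.sum_single (show TotalPath V →₀ k from x)).symm
  rw [hx]
  refine Submodule.sum_mem _ fun p hp => single_mem_arrowIdeal_sq _ _ ?_
  by_contra hlt
  rw [Finsupp.mem_support_iff] at hp
  obtain ⟨a, b, p⟩ := p
  cases p with
  | nil => exact hp (congrFun h0 a)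
  | cons p f =>
    cases p with
    | nil => exact hp (h1 _ _ f)
    | cons p e => simp [TotalPath.length] at hlt

end PathAlgebra

/-! ### Coordinates, radical and idempotents of `kQ/J²` -/

namespace RadSqZero

lemma toRadSqZero_surjective : Function.Surjective (toRadSqZero (k := k) (V := V)) :=
  Ideal.Quotient.mk_surjective

variable (k V) in
/-- The augmentation `kQ/J² → kQ_0`. -/
def vertexCoeff : RadSqZero k V →+* (V → k) :=
  Ideal.Quotient.lift (arrowIdeal k V ^ 2) (PathAlgebra.vertexCoeff k V)
    fun _ hx => (PathAlgebra.coeff_of_mem_arrowIdeal_sq hx).1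

/-- The coefficient of an arrow. -/
def arrowCoeff {a b : V} (α : a ⟶ b) : RadSqZero k V →+ k :=
  QuotientAddGroup.lift (arrowIdeal k V ^ 2).toAddSubgroup (PathAlgebra.arrowCoeff α)
    fun _ hx => (PathAlgebra.coeff_of_mem_arrowIdeal_sq hx).2 _ _ α

lemma arrowCoeff_mul {a b : V} (α : a ⟶ b) (x y : RadSqZero k V) :
    arrowCoeff α (x * y) =
      vertexCoeff k V x b * arrowCoeff α y + arrowCoeff α x * vertexCoeff k V y a := by
  obtain ⟨x, rfl⟩ := toRadSqZero_surjective x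
  obtain ⟨y, rfl⟩ := toRadSqZero_surjective y
  rw [← map_mul]
  exact PathAlgebra.arrowCoeff_mul α x y

lemma eq_zero_of_coeff {x : RadSqZero k V} (h0 : vertexCoeff k V x = 0)
    (h1 : ∀ (a b : V) (α : a ⟶ b), arrowCoeff α x = 0) : x = 0 := by
  obtain ⟨x, rfl⟩ := toRadSqZero_surjective x
  exact Ideal.Quotient.eq_zero_iff_mem.2 (PathAlgebra.mem_arrowIdeal_sq h0 h1)

variable (k V) in
/-- The embedding `kQ_0 → kQ/J²`. -/
def ofVertex : (V → k) →+* RadSqZero k V := toRadSqZero.comp PathAlgebra.vertexHom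

/-- The class of an arrow in `kQ/J²`. -/
abbrev ofArrow {a b : V} (α : a ⟶ b) : RadSqZero k V := toRadSqZero (PathAlgebra.arrow α)

lemma vertexCoeff_ofVertex (c : V → k) : vertexCoeff k V (ofVertex k V c) = c :=
  PathAlgebra.vertexCoeff_vertexHom c

lemma vertexCoeff_ofArrow {a b : V} (α : a ⟶ b) : vertexCoeff k V (ofArrow α) = 0 :=
  PathAlgebra.vertexCoeff_arrow α

lemma arrowCoeff_ofArrow_self {a b : V} (α : a ⟶ b) :
    arrowCoeff (k := k) α (ofArrow α) = 1 :=
  Finsupp.single_eq_same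

lemma arrowCoeff_ofArrow_of_ne {a b c d : V} (α : a ⟶ b) (β : c ⟶ d)
    (h : arrowPath α ≠ arrowPath β) : arrowCoeff (k := k) β (ofArrow α) = 0 :=
  Finsupp.single_eq_of_ne h.symm

/-- Multiplication by vertex elements on an arrow. -/
lemma ofVertex_mul_ofArrow {a b : V} (α : a ⟶ b) (c d : V → k) (h : c b = d a) :
    ofVertex k V c * ofArrow α = ofArrow α * ofVertex k V d := by
  have := congrArg toRadSqZero (PathAlgebra.vertexHom_mul_arrow α c d h)
  rwa [map_mul, map_mul] at this

variable (k V) in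
/-- The radical of `kQ/J²`. -/
abbrev radical : Ideal (RadSqZero k V) := RingHom.ker (vertexCoeff k V)

lemma mul_eq_zero_of_mem_radical (x : RadSqZero k V) (hx : x ∈ radical k V) (y : RadSqZero k V)
    (hy : y ∈ radical k V) : x * y = 0 := by
  rw [RingHom.mem_ker] at hx hy
  refine eq_zero_of_coeff (by rw [map_mul, hx, zero_mul]) fun a b α => ?_
  rw [arrowCoeff_mul, hx, hy]
  simp

lemma ofArrow_mem_radical {a b : V} (α : a ⟶ b) : ofArrow α ∈ radical k V :=
  vertexCoeff_ofArrow α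

/-- The quotient is an image of `kQ_0`, a finite product of fields. -/
instance : IsSemisimpleRing (RadSqZero k V ⧸ radical k V) := by
  refine RingHom.isSemisimpleRing_of_surjective
    ((Ideal.Quotient.mk (radical k V)).comp (ofVertex k V)) fun x => ?_
  obtain ⟨x, rfl⟩ := Ideal.Quotient.mk_surjective x
  refine ⟨vertexCoeff k V x, ?_⟩
  rw [RingHom.comp_apply, Ideal.Quotient.eq, RingHom.mem_ker, map_sub, vertexCoeff_ofVertex,
    sub_self]

/-- A section of the free cover of `T` writes `x` as a combination whose coefficients are values of
linear functionals at `x`. -/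
lemma mem_radical_smul_of_projective {T : Type*} [AddCommGroup T]
    [Module (RadSqZero k V) T] [Module.Projective (RadSqZero k V) T] {x : T}
    (h : ∀ φ : T →ₗ[RadSqZero k V] RadSqZero k V, φ x ∈ radical k V) :
    x ∈ radical k V • (⊤ : Submodule (RadSqZero k V) T) := by
  obtain ⟨s, hs⟩ := Module.Projective.out (R := RadSqZero k V) (P := T)
  rw [← hs x, Finsupp.linearCombination_apply, Finsupp.sum]
  exact Submodule.sum_mem _ fun t _ =>
    Submodule.smul_mem_smul (h (Finsupp.lapply t ∘ₗ s)) Submodule.mem_top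

/-- The coefficient of an arrow in a combination of arrows with the same target. -/
lemma arrowCoeff_sum_ofArrow_mul [∀ a b : V, Fintype (a ⟶ b)] {b : V}
    (x : ∀ a, (a ⟶ b) → RadSqZero k V) {c : V} (β : c ⟶ b) :
    arrowCoeff β (∑ a : V, ∑ α : a ⟶ b, ofArrow α * x a α) = vertexCoeff k V (x c β) c := by
  rw [map_sum, Finset.sum_eq_single c, map_sum, Finset.sum_eq_single β]
  · rw [arrowCoeff_mul, vertexCoeff_ofArrow, arrowCoeff_ofArrow_self]
    simp
  · intro α _ h
    rw [arrowCoeff_mul, vertexCoeff_ofArrow, arrowCoeff_ofArrow_of_ne]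
    · simp
    · exact fun h' => h (arrowPath_injective h')
  · simp
  · intro a _ h
    rw [map_sum]
    refine Finset.sum_eq_zero fun α _ => ?_
    rw [arrowCoeff_mul, vertexCoeff_ofArrow, arrowCoeff_ofArrow_of_ne]
    · simp
    · exact fun h' => h (congrArg Sigma.fst h')
  · simp

variable [DecidableEq V]

variable (k) in
/-- The idempotent of a vertex. -/
def idem (i : V) : RadSqZero k V := ofVertex k V (Pi.single i 1)

lemma vertexCoeff_idem (i : V) : vertexCoeff k V (idem k i) = Pi.single i 1 :=
  vertexCoeff_ofVertex _

lemma idem_mul_idem (i : V) : idem k i * idem k i = idem k i := by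
  rw [idem, ← map_mul, ← Pi.single_mul, one_mul]

lemma sum_idem : ∑ i : V, idem k i = 1 := by
  simp only [idem]
  rw [← map_sum, ← map_one (ofVertex k V)]
  congr 1
  exact Finset.univ_sum_single 1

lemma ofArrow_mul_idem {a b : V} (α : a ⟶ b) : ofArrow (k := k) α * idem k a = ofArrow α := by
  have h := ofVertex_mul_ofArrow (k := k) α 1 (Pi.single a 1) (by simp)
  rw [map_one, one_mul] at h
  exact h.symm

lemma ofVertex_mul_idem (c : V → k) (i : V) :
    ofVertex k V c * idem k i = ofVertex k V (fun _ => c i) * idem k i := by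
  rw [idem, ← map_mul, ← map_mul]
  congr 1
  ext j
  by_cases h : j = i
  · subst h; simp
  · simp [h]

variable [∀ a b : V, Fintype (a ⟶ b)]

/-- The elements of the radical are combinations of arrows. -/
lemma idem_mul_eq_sum {x : RadSqZero k V} (hx : x ∈ radical k V) (b : V) :
    idem k b * x = ∑ a : V, ∑ α : a ⟶ b, ofArrow α * ofVertex k V fun _ => arrowCoeff α x := by
  rw [RingHom.mem_ker] at hx
  rw [← sub_eq_zero]
  refine eq_zero_of_coeff ?_ fun c d β => ?_
  · rw [map_sub, map_mul, hx, mul_zero, map_sum, zero_sub, neg_eq_zero]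
    refine Finset.sum_eq_zero fun a _ => ?_
    rw [map_sum]
    refine Finset.sum_eq_zero fun α _ => ?_
    rw [map_mul, vertexCoeff_ofArrow, zero_mul]
  · rw [map_sub, arrowCoeff_mul, hx, vertexCoeff_idem]
    by_cases h : d = b
    · subst h
      rw [arrowCoeff_sum_ofArrow_mul, vertexCoeff_ofVertex]
      simp
    · have hs : arrowCoeff β (∑ a : V, ∑ α : a ⟶ b,
          ofArrow α * ofVertex k V fun _ => arrowCoeff α x) = 0 := by
        rw [map_sum]
        refine Finset.sum_eq_zero fun a _ => ?_
        rw [map_sum]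
        refine Finset.sum_eq_zero fun α _ => ?_
        rw [arrowCoeff_mul, vertexCoeff_ofArrow, arrowCoeff_ofArrow_of_ne]
        · simp
        · exact fun h' => h (congrArg (fun p : TotalPath V => p.2.1) h').symm
      rw [hs, Pi.single_eq_of_ne h]
      simp

variable {T : Type*} [AddCommGroup T] [Module (RadSqZero k V) T]

/-- The elements of `rad · T` are combinations of arrows. -/
lemma exists_sum_of_mem_radical_smul {m : T}
    (hm : m ∈ radical k V • (⊤ : Submodule (RadSqZero k V) T)) (b : V) :
    ∃ n : ∀ a, (a ⟶ b) → T, (∀ a α, idem k a • n a α = n a α) ∧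
      idem k b • m = ∑ a : V, ∑ α : a ⟶ b, ofArrow (k := k) α • n a α := by
  suffices h : ∃ n : ∀ a, (a ⟶ b) → T,
      idem k b • m = ∑ a : V, ∑ α : a ⟶ b, ofArrow (k := k) α • n a α by
    obtain ⟨n, hn⟩ := h
    refine ⟨fun a α => idem k a • n a α, fun a α => by rw [smul_smul, idem_mul_idem], ?_⟩
    rw [hn]
    -- Replacing `n_α` by `e_a n_α` is harmless because `α e_a = α`.
    simp only [smul_smul, ofArrow_mul_idem]
  induction hm using Submodule.smul_induction_on' with
  | smul x hx t _ =>
    refine ⟨fun a α => (ofVertex k V fun _ => arrowCoeff α x) • t, ?_⟩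
    rw [smul_smul, idem_mul_eq_sum hx]
    simp only [Finset.sum_smul, smul_smul]
  | add m _ m' _ h h' =>
    obtain ⟨n, hn⟩ := h
    obtain ⟨n', hn'⟩ := h'
    refine ⟨fun a α => n a α + n' a α, ?_⟩
    rw [smul_add, hn, hn']
    simp only [smul_add, Finset.sum_add_distrib]

/-- In a projective module, a relation between the arrows with a given target has coefficients
in the radical. -/
lemma idem_smul_mem_of_sum_eq_zero [Module.Projective (RadSqZero k V) T] {b : V}
    (x : ∀ a, (a ⟶ b) → T) (hx : ∑ a : V, ∑ α : a ⟶ b, ofArrow (k := k) α • x a α = 0)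
    {a : V} (α : a ⟶ b) :
    idem k a • x a α ∈ radical k V • (⊤ : Submodule (RadSqZero k V) T) := by
  refine mem_radical_smul_of_projective fun φ => ?_
  -- The coefficient of `α` in `φ` of the relation is the vertex coefficient at `a` of `φ(x_α)`; it
  -- decides whether `φ(e_a x_α)` is in the radical.
  have h := congrArg (fun t => arrowCoeff α (φ t)) hx
  simp only [map_sum φ, map_smul, smul_eq_mul, map_zero] at h
  rw [arrowCoeff_sum_ofArrow_mul fun a α => φ (x a α)] at h
  rw [RingHom.mem_ker, map_smul, smul_eq_mul, map_mul, vertexCoeff_idem]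
  ext i
  by_cases hi : i = a
  · subst hi; simp [h]
  · simp [hi]

end RadSqZero

end Coefficients

/-! ### Maps out of the generator -/

section Generator

open RadSqZero Opposite

variable {k : Type u} [Field k] {V : Type v} [Quiver.{w} V] [Fintype V]

section Lift

variable {T : Type*} [AddCommGroup T] [Module (RadSqZero k V) T]

/-- The additive extension to `kQ^op` of a family of elements indexed by the paths. -/
def pathExtend (ρ : TotalPath Vᵒᵖ → T) : PathAlgebra k Vᵒᵖ →+ T :=
  Finsupp.liftAddHom fun p =>
    { toFun := fun c : k => (ofVertex k V fun _ => c) • ρ p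
      map_zero' := by
        change ofVertex k V 0 • ρ p = 0
        rw [map_zero, zero_smul]
      map_add' := fun c d => by
        change ofVertex k V ((fun _ => c) + fun _ => d) • ρ p = _
        rw [map_add, add_smul] }

lemma pathExtend_single (ρ : TotalPath Vᵒᵖ → T) (p : TotalPath Vᵒᵖ) (c : k) :
    pathExtend ρ (show PathAlgebra k Vᵒᵖ from Finsupp.single p c) =
      (ofVertex k V fun _ => c) • ρ p :=
  Finsupp.liftAddHom_apply_single _ _ _

lemma vertexHomOp_mul_single (c : V → k) (p : TotalPath Vᵒᵖ) (d : k) :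
    vertexHomOp k V c * (show PathAlgebra k Vᵒᵖ from Finsupp.single p d) =
      (show PathAlgebra k Vᵒᵖ from Finsupp.single p (c p.2.1.unop * d)) :=
  vertexSum_pathMul_single (fun i : Vᵒᵖ => c i.unop) p d

variable [DecidableEq V]

/-- On `e_i T` an element `c` of `kQ_0` acts as the scalar `c i`. So placing `ρ(p)` at the end
vertex of `p` is what makes the extension `kQ_0`-linear, as needed to descend to the tensor product.
-/
lemma pathExtend_smul (ρ : TotalPath Vᵒᵖ → T) (hρ : ∀ p, idem k p.2.1.unop • ρ p = ρ p)
    (c : V → k) (z : PathAlgebra k Vᵒᵖ) :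
    pathExtend ρ (c • z) = ofVertex k V c • pathExtend ρ z := by
  induction z using PathAlgebra.induction_single with
  | zero => rw [smul_zero, map_zero, smul_zero]
  | add x y hx hy => rw [smul_add, map_add, map_add, hx, hy, smul_add]
  | single p d =>
    rw [vertex_smul_op, vertexHomOp_mul_single, pathExtend_single, pathExtend_single, smul_smul, ← map_mul, ← hρ p, smul_smul, smul_smul, ofVertex_mul_idem (c * _)]
    rfl

/-- The linear map `y ⊗ p ↦ y ρ(p)` out of `kQ/J² ⊗_{kQ_0} kQ^op`. -/
def genLift (ρ : TotalPath Vᵒᵖ → T) (hρ : ∀ p, idem k p.2.1.unop • ρ p = ρ p) :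
    GenCarrier k V →ₗ[RadSqZero k V] T where
  toFun := TensorProduct.liftAddHom
    { toFun := fun y => (DistribSMul.toAddMonoidHom T y).comp (pathExtend ρ)
      map_zero' := by ext z : 1; simp
      map_add' := fun y y' => by ext z : 1; simp [add_smul] }
    (fun c y z => by
      change (y * ofVertex k V c) • pathExtend ρ z = y • pathExtend ρ (c • z)
      rw [pathExtend_smul ρ hρ, mul_smul])
  map_add' x y := map_add _ x y
  map_smul' r x := by
    induction x using TensorProduct.induction_on with
    | zero => simp
    | add x y h h' => simp only [smul_add, map_add, h, h']
    | tmul y z =>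
      rw [TensorProduct.smul_tmul']
      exact mul_smul r y (pathExtend ρ z)

lemma genLift_tmul (ρ : TotalPath Vᵒᵖ → T) (hρ : ∀ p, idem k p.2.1.unop • ρ p = ρ p)
    (y : RadSqZero k V) (z : PathAlgebra k Vᵒᵖ) :
    genLift ρ hρ (y ⊗ₜ[V → k] z) = y • pathExtend ρ z := rfl

end Lift

/-- The basis element `1 ⊗ p` of `kQ/J² ⊗_{kQ_0} kQ^op`. -/
def genBasis (p : TotalPath Vᵒᵖ) : GenCarrier k V :=
  1 ⊗ₜ[V → k] (show PathAlgebra k Vᵒᵖ from Finsupp.single p 1)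

lemma ofVertex_smul_one_tmul (c : V → k) (z : PathAlgebra k Vᵒᵖ) :
    ofVertex k V c • ((1 : RadSqZero k V) ⊗ₜ[V → k] z) = 1 ⊗ₜ[V → k] (c • z) := by
  rw [TensorProduct.smul_tmul', ← TensorProduct.smul_tmul, smul_eq_mul, mul_one,
    vertex_smul_radSqZero, one_mul]
  rfl

lemma tmul_single (y : RadSqZero k V) (p : TotalPath Vᵒᵖ) (c : k) :
    y ⊗ₜ[V → k] (show PathAlgebra k Vᵒᵖ from Finsupp.single p c) =
      (y * ofVertex k V fun _ => c) • genBasis (k := k) p := by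
  rw [mul_smul, genBasis, ofVertex_smul_one_tmul, vertex_smul_op, vertexHomOp_mul_single,
    TensorProduct.smul_tmul', smul_eq_mul, mul_one, mul_one]

/-- The elements `1 ⊗ p` generate over `kQ/J²`, since scalars in the right factor move across the
tensor sign by `tmul_single`. -/
lemma genCarrier_hom_ext {T : Type*} [AddCommGroup T] [Module (RadSqZero k V) T]
    {f g : GenCarrier k V →ₗ[RadSqZero k V] T} (h : ∀ p, f (genBasis p) = g (genBasis p)) :
    f = g := by
  apply LinearMap.ext
  intro x
  induction x using TensorProduct.induction_on with
  | zero => simp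
  | add x y hx hy => rw [map_add, map_add, hx, hy]
  | tmul y z =>
    induction z using PathAlgebra.induction_single with
    | zero => rw [TensorProduct.tmul_zero, map_zero, map_zero]
    | add z z' hz hz' => rw [TensorProduct.tmul_add, map_add, map_add, hz, hz']
    | single p c => rw [tmul_single, map_smul, map_smul, h]

/-- The path `α* p`, for an arrow `α` ending at the end of the path `p` of `Q^op`. -/
def consPath (p : TotalPath Vᵒᵖ) {a : V} (α : a ⟶ p.2.1.unop) : TotalPath Vᵒᵖ :=
  ⟨p.1, op a, p.2.2.cons α.op⟩

variable (k V) in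
/-- The element `1 ⊗ 1`. -/
def genOne : GenCarrier k V := 1 ⊗ₜ[V → k] 1

lemma sum_genBasis_trivialPath :
    genOne k V = ∑ i : V, genBasis (trivialPath (op i)) := by
  have h : (1 : PathAlgebra k Vᵒᵖ) =
      ∑ i : V, (show PathAlgebra k Vᵒᵖ from Finsupp.single (trivialPath (op i)) 1) := by
    refine Eq.trans ?_ (equivToOpposite.sum_comp fun i : Vᵒᵖ =>
      (show PathAlgebra k Vᵒᵖ from Finsupp.single (trivialPath i) 1)).symm
    rfl
  rw [genOne, h, TensorProduct.tmul_sum]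
  rfl

lemma genDifferential_genBasis [∀ a b : V, Fintype (a ⟶ b)] (p : TotalPath Vᵒᵖ) :
    genDifferential k V (genBasis p) =
      ∑ a : V, ∑ α : a ⟶ p.2.1.unop, ofArrow (k := k) α • genBasis (consPath p α) := by
  rw [genBasis, genDifferential_tmul]
  refine Finset.sum_congr rfl fun a _ => ?_
  rw [Finset.sum_eq_single p.2.1.unop]
  · refine Finset.sum_congr rfl fun α _ => ?_
    rw [genBasis, TensorProduct.smul_tmul', smul_eq_mul, mul_one, one_mul]
    congr 1
    refine (pathMul_single (arrowPath α.op) p (1 : k) 1).trans ?_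
    rw [mulSingle, dif_pos (by rfl), one_mul]
    rfl
  -- An arrow not ending at the end of `p` contributes nothing, because then `α* p = 0`.
  · intro b _ hb
    refine Finset.sum_eq_zero fun α _ => ?_
    have h : (PathAlgebra.arrow α.op : PathAlgebra k Vᵒᵖ) *
        (show PathAlgebra k Vᵒᵖ from Finsupp.single p 1) = 0 := by
      refine (pathMul_single (arrowPath α.op) p (1 : k) 1).trans ?_
      rw [mulSingle, dif_neg]
      · rfl
      · intro h
        exact hb (congrArg unop h).symm
    rw [h, TensorProduct.tmul_zero]
  · simp

lemma genDifferential_genOne_mem [∀ a b : V, Fintype (a ⟶ b)] :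
    genDifferential k V (genOne k V) ∈
      radical k V • (⊤ : Submodule (RadSqZero k V) (GenCarrier k V)) := by
  rw [sum_genBasis_trivialPath, map_sum]
  refine Submodule.sum_mem _ fun i _ => ?_
  rw [genDifferential_genBasis]
  exact Submodule.sum_mem _ fun a _ => Submodule.sum_mem _ fun α _ =>
    Submodule.smul_mem_smul (ofArrow_mem_radical α) Submodule.mem_top

variable [DecidableEq V]

lemma idem_smul_genBasis (p : TotalPath Vᵒᵖ) :
    idem k p.2.1.unop • genBasis (k := k) p = genBasis p := by
  rw [idem, genBasis, ofVertex_smul_one_tmul, vertex_smul_op, vertexHomOp_mul_single]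
  simp

lemma genLift_genBasis {T : Type*} [AddCommGroup T] [Module (RadSqZero k V) T]
    (ρ : TotalPath Vᵒᵖ → T) (hρ : ∀ p, idem k p.2.1.unop • ρ p = ρ p) (p : TotalPath Vᵒᵖ) :
    genLift ρ hρ (genBasis p) = ρ p := by
  rw [genBasis, genLift_tmul, pathExtend_single, one_smul]
  change ofVertex k V 1 • ρ p = ρ p
  rw [map_one, one_smul]

lemma genBasis_trivialPath (i : V) :
    genBasis (trivialPath (op i)) = idem k i • genOne k V := by
  have h : (Pi.single i 1 : V → k) • (1 : PathAlgebra k Vᵒᵖ) =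
      (show PathAlgebra k Vᵒᵖ from Finsupp.single (trivialPath (op i)) 1) := by
    rw [vertex_smul_op, mul_one]
    change vertexSum (fun j : Vᵒᵖ => (Pi.single i 1 : V → k) j.unop) = _
    rw [vertexSum, Finset.sum_eq_single (op i)]
    · simp
    · intro j _ hj
      rw [Pi.single_eq_of_ne fun h => hj (unop_injective h), Finsupp.single_zero]
    · simp
  rw [genOne, idem, ofVertex_smul_one_tmul, h]
  rfl

variable [∀ a b : V, Fintype (a ⟶ b)]

/-! ### Solving the recursion along the paths -/

section Recursion

variable (T : DiffProj.{max u v w, max u v w} (RadSqZero k V))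

/-- The solutions at one path: the elements at the end of `p` which are sent to `ψ(p)` modulo
the radical. -/
def IsPartialSolution (ψ : TotalPath Vᵒᵖ → T.carrier) (p : TotalPath Vᵒᵖ) (t : T.carrier) : Prop :=
  idem k p.2.1.unop • t = t ∧
    ψ p - T.d t ∈ radical k V • (⊤ : Submodule (RadSqZero k V) T.carrier)

variable {T}

/-- One step of the recursion. Expanding `ε(ψ(p) - dt)` in arrows defines the next values `n_α`;
applying `d` gives `∑ α (ψ(α* p) - d n_α) = 0`, and projectivity puts each term `ψ(α* p) - d n_α` in
the radical part. The sign `ε` lets one recursion serve both lifting and null homotopies. -/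
lemma IsPartialSolution.exists_next {ψ : TotalPath Vᵒᵖ → T.carrier}
    (hψ : ∀ p, idem k p.2.1.unop • ψ p = ψ p) {ε : ℤ} (hε : ε * ε = 1)
    (hd : ∀ p, T.d (ψ p) = ε • ∑ a : V, ∑ α : a ⟶ p.2.1.unop, ofArrow (k := k) α •
      ψ (consPath p α)) {p : TotalPath Vᵒᵖ} {t : T.carrier} (ht : IsPartialSolution T ψ p t) :
    ∃ n : ∀ a, (a ⟶ p.2.1.unop) → T.carrier,
      (∀ a α, IsPartialSolution T ψ (consPath p α) (n a α)) ∧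
      ψ p - T.d t = ε • ∑ a : V, ∑ α : a ⟶ p.2.1.unop, ofArrow (k := k) α • n a α := by
  have := T.projective
  obtain ⟨n, hn, hs⟩ := exists_sum_of_mem_radical_smul (zsmul_mem ht.2 ε) p.2.1.unop
  have he : idem k p.2.1.unop • (ε • (ψ p - T.d t)) = ε • (ψ p - T.d t) := by
    rw [smul_comm, smul_sub, hψ, ← map_smul, ht.1]
  rw [he] at hs
  have hs' : ψ p - T.d t = ε • ∑ a : V, ∑ α : a ⟶ p.2.1.unop, ofArrow (k := k) α • n a α := by
    rw [← hs, smul_smul, hε, one_smul]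
  refine ⟨n, fun a α => ⟨hn a α, ?_⟩, hs'⟩
  have key : ∑ a : V, ∑ α : a ⟶ p.2.1.unop, ofArrow (k := k) α •
      (ψ (consPath p α) - T.d (n a α)) = 0 := by
    simp only [smul_sub, Finset.sum_sub_distrib]
    rw [sub_eq_zero]
    have h := congrArg T.d hs
    rw [map_zsmul, map_sub, d_d, sub_zero, hd, smul_smul, hε, one_smul] at h
    simpa only [map_sum, map_smul] using h
  have h := idem_smul_mem_of_sum_eq_zero _ key α
  rw [smul_sub, ← map_smul, hn] at h
  have hc : idem k a • ψ (consPath p α) = ψ (consPath p α) := hψ (consPath p α)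
  rwa [hc] at h

/-- The recursive equation `d ρ(p) + ε ∑_α α ρ(α* p) = ψ(p)` has a solution with given initial
values. -/
lemma exists_solution {ψ : TotalPath Vᵒᵖ → T.carrier}
    (hψ : ∀ p, idem k p.2.1.unop • ψ p = ψ p) {ε : ℤ} (hε : ε * ε = 1)
    (hd : ∀ p, T.d (ψ p) = ε • ∑ a : V, ∑ α : a ⟶ p.2.1.unop, ofArrow (k := k) α •
      ψ (consPath p α)) (t : V → T.carrier)
    (ht : ∀ i, IsPartialSolution T ψ (trivialPath (op i)) (t i)) :
    ∃ ρ : TotalPath Vᵒᵖ → T.carrier, (∀ p, idem k p.2.1.unop • ρ p = ρ p) ∧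
      (∀ i, ρ (trivialPath (op i)) = t i) ∧
      ∀ p, ψ p - T.d (ρ p) = ε • ∑ a : V, ∑ α : a ⟶ p.2.1.unop, ofArrow (k := k) α •
        ρ (consPath p α) := by
  choose n hn hs using fun (p : TotalPath Vᵒᵖ) (t : T.carrier) (ht : IsPartialSolution T ψ p t) =>
    ht.exists_next hψ hε hd
  -- The subtype carries the invariant needed for the next step. The values at all `α* p` come from
  -- the same choice at `p`, so the equation at `p` holds by construction.
  let build (x : Vᵒᵖ) {y : Vᵒᵖ} (p : Quiver.Path x y) :
      {t : T.carrier // IsPartialSolution T ψ ⟨x, y, p⟩ t} :=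
    Quiver.Path.rec (motive := fun y p => {t : T.carrier // IsPartialSolution T ψ ⟨x, y, p⟩ t})
      ⟨t x.unop, ht x.unop⟩
      (fun {_ _} p e r => ⟨n ⟨x, _, p⟩ r.1 r.2 _ e.unop, hn ⟨x, _, p⟩ r.1 r.2 _ e.unop⟩) p
  exact ⟨fun p => (build p.1 p.2.2).1, fun p => (build p.1 p.2.2).2.1, fun i => rfl,
    fun p => hs p _ (build p.1 p.2.2).2⟩

end Recursion

/-- With `ψ = 0` and `ε = -1` the recursion reads `dρ(p) = ∑ α ρ(α* p)`, which says that `y ⊗ p ↦ y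
ρ(p)` commutes with the differentials. The initial values `e_i m` add up to `m`. -/
lemma generator_lift (T : DiffProj.{max u v w, max u v w} (RadSqZero k V)) (m : T.carrier)
    (hm : T.d m ∈ radical k V • (⊤ : Submodule (RadSqZero k V) T.carrier)) :
    ∃ f : generator k V ⟶ T, f.map (genOne k V) = m := by
  obtain ⟨ρ, hρ, h0, hs⟩ := exists_solution (T := T) (ψ := 0) (ε := -1) (by simp) (by simp)
    (by simp) (fun i => idem k i • m) fun i => ⟨by
      change idem k i • idem k i • m = _
      rw [smul_smul, idem_mul_idem], by
      rw [Pi.zero_apply, zero_sub, map_smul]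
      exact Submodule.neg_mem _ (Submodule.smul_mem _ _ hm)⟩
  refine ⟨⟨genLift ρ hρ, genCarrier_hom_ext fun p => ?_⟩, ?_⟩
  · change genLift ρ hρ (genDifferential k V (genBasis p)) = T.d (genLift ρ hρ (genBasis p))
    have h := hs p
    rw [Pi.zero_apply, zero_sub, neg_smul, one_smul, neg_inj] at h
    rw [genDifferential_genBasis, genLift_genBasis, h]
    simp only [map_sum, map_smul, genLift_genBasis]
  · change genLift ρ hρ (genOne k V) = m
    rw [sum_genBasis_trivialPath, map_sum]
    simp only [genLift_genBasis, h0]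
    rw [← Finset.sum_smul, sum_idem, one_smul]

/-- With `ψ(p) = f(1 ⊗ p)` and `ε = 1` the recursion reads `f(1 ⊗ p) = dρ(p) + ∑ α ρ(α* p)`, so `y ⊗
p ↦ y ρ(p)` is a null homotopy of `f`. Its initial values are `e_i y`. -/
lemma generator_null (T : DiffProj.{max u v w, max u v w} (RadSqZero k V)) (f : generator k V ⟶ T)
    (y : T.carrier) (hy : f.map (genOne k V) - T.d y ∈
      radical k V • (⊤ : Submodule (RadSqZero k V) T.carrier)) :
    (toHo (RadSqZero k V)).map f = 0 := by
  let F : GenCarrier k V →ₗ[RadSqZero k V] T.carrier := f.map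
  have hF (x : GenCarrier k V) : T.d (F x) = F (genDifferential k V x) := (map_d f x).symm
  obtain ⟨ρ, hρ, h0, hs⟩ := exists_solution (T := T) (ψ := fun p => F (genBasis p)) (ε := 1)
    (fun p => by rw [← map_smul, idem_smul_genBasis]) (by simp)
    (fun p => by
      rw [hF, genDifferential_genBasis, one_smul]
      simp only [map_sum, map_smul])
    (fun i => idem k i • y) fun i => ⟨by
      change idem k i • idem k i • y = _
      rw [smul_smul, idem_mul_idem], by
      change F (genBasis (trivialPath (op i))) - T.d (idem k i • y) ∈ _
      rw [genBasis_trivialPath, map_smul, map_smul, ← smul_sub]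
      exact Submodule.smul_mem _ _ hy⟩
  rw [toHo_map_eq_zero_iff]
  have key : F = genLift ρ hρ ∘ₗ genDifferential k V + T.d ∘ₗ genLift ρ hρ := by
    refine genCarrier_hom_ext fun p => ?_
    rw [LinearMap.add_apply, LinearMap.comp_apply, LinearMap.comp_apply,
      genDifferential_genBasis, genLift_genBasis, ← sub_eq_iff_eq_add, hs, one_smul]
    simp only [map_sum, map_smul, genLift_genBasis]
  exact ⟨genLift ρ hρ, LinearMap.congr_fun key⟩

end Generator

end DiffProjSqZero

end

/-! ### The main theorem -/

open DiffProjSqZero CategoryTheory in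
theorem theorem1p3 (k : Type u) [Field k] (V : Type v) [Quiver.{w} V] [Fintype V]
    [∀ a b : V, Fintype (a ⟶ b)] :
    (∃ P : Pretriangulated (HoDiffProj.{max u v w, max u v w} (RadSqZero k V)),
      P.distinguishedTriangles = exactTriangles (RadSqZero k V) ∧
      IsTriangulated (HoDiffProj.{max u v w, max u v w} (RadSqZero k V))) ∧
    DiffProjSqZero.IsCompactlyGenerated.{max u v w + 1, max u v w, max u v w}
      (HoDiffProj.{max u v w, max u v w} (RadSqZero k V)) ∧
    IsCompactGenerator.{max u v w + 1, max u v w, max u v w}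
      ((toHo.{max u v w, max u v w} (RadSqZero k V)).obj (generator k V)) := by
  classical
  have hC : IsCompactGenerator.{max u v w + 1, max u v w, max u v w}
      ((toHo.{max u v w, max u v w} (RadSqZero k V)).obj (generator k V)) :=
    isCompactGenerator_of_eval (RadSqZero.radical k V) RadSqZero.mul_eq_zero_of_mem_radical
      genDifferential_genOne_mem generator_lift generator_null
  exact ⟨⟨conePretriangulated _, rfl, conePretriangulated_isTriangulated _⟩,
    ⟨hasCoproducts_hoDiffProj, _, _, hC⟩, hC⟩
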